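/- **Theorem (Correctness of the Platypus protocol).** *Model.* A finite set $P$ of users runs a parentchain $\Omega$ with validators $V_\Omega\subseteq P$; every account is controlled by one user. A coalition $F\subseteq P$ of $f=|F|$ users is Byzantine (it may send any message or transaction whose signatures exist, but cannot forge signatures of the other, *correct*, users). The network is partially synchronous: there are an unknown time $GST$ and an unknown bound $\Delta$ such that a message sent at time $t$ by a correct user to a correct user is delivered by time $\max(t,GST)+\Delta$. A rule of the protocol that stays enabled at a correct user is eventually applied. A blockchain with validators $V$ is an *unforkable BFT chain* if, whenever fewer than $|V|/3$ of the validators are Byzantine: no two correct users decide different blocks at the same height; decided blocks are valid and consist of transactions that were sent to the chain; if one correct user of the chain decides at some height then all do; and a transaction sent by a correct user that from some time on remains valid is eventually written. Let $m_v$ be the number of validators required for the childchain $\Psi$ and $\tau(n)=\lfloor 2n/3\rfloor+1$. *Protocol.* **Creation:** users multicast signed messages that offer coins, as validators or mere users (an initiator first, the others in reply). A volunteer gathers messages of distinct users; when it has exactly $m_v$ validators it builds, signs and multicasts to them a creation transaction with the gathered messages and the balances. A validator who receives a creation transaction, sees none written in $\Omega$ and verifies it (exactly $m_v$ validators, signed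 join messages of distinct users, available deposits) signs it, and multicasts it to the validators if it has fewer than $\tau(m_v)$ validator signatures, and otherwise sends it to $\Omega$. The first creation transaction written in $\Omega$ determines the users $Q$ and validators $V_\Psi\subseteq Q$ of $\Psi$ and locks the coins. In $\Psi$ the current owner of a coin may transfer it to an account (of a user in $Q$) which has not held this coin in $\Psi$ before, until a bulk close is written in $\Psi$. **Bulk close:** a user of $\Psi$ may launch a bulk close, i.e. sign and multicast to $V_\Psi$ a transaction naming the current owners of all coins in $\Psi$. A validator who receives one that is not written in $\Psi$ and verifies that the owners are the current ones signs it, and multicasts it to $V_\Psi$ if it has fewer than $\tau(|V_\Psi|)$ validator signatures, and otherwise sends it to $\Psi$. Sending it with enough signatures to $\Psi$ is *proposing COMMIT*. When a bulk close (resp. an abort transaction) is written in $\Psi$, every correct $p\in Q$ *decides COMMIT* (resp. *ABORT*) for it and sends it to $\Omega$; $\Omega$ accepts a bulk close only with $\tau(|V_\Psi|)$ validator signatures and attestations of $\tau(|V_\Psi|)$ validators that it is written in $\Psi$. **Abort:** a user of $\Psi$ who receives a bulk close naming as owner of a coin an account that has spent the coin in $\Psi$ sends to $\Omega$ and $\Psi$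 an abort transaction with a proof: the first block showing such a payment, attested by $\tau(|V_\Psi|)$ validators, and the list of validators that validated both the bulk close and a block from there on. Sending it is *proposing ABORT*. A bulk close *lists* the sequence $seq$ of transfers if $seq$ is the sequence of transfers recorded in $\Psi$ up to some point and leads from the initial balances to the owners named; proposals and decisions for the bulk close are proposals and decisions for $seq$. *Statement.* Suppose that $3f<m_v$, that fewer than $|V_\Omega|/3$ of the validators of $\Omega$ are Byzantine, that $\Omega$ is an unforkable BFT chain, and that so is $\Psi$ with the validators $V_\Psi$ named in its creation transaction. Then the Platypus protocol solves the offchain problem. Precisely, in every execution: 1. *Creation.* If at least $m_v$ correct users volunteer as validators, and no user spends on $\Omega$ a coin that it offers, then $\Psi$ is eventually created, in the view of every correct user. Whenever $\Psi$ is created, $|V_\Psi|=m_v$, its creation transaction bears signatures of at least $\tau(m_v)$ validators, and every correct user included in it signed the join message by which it is included. Whenever $\Psi$ is created, moreover: 2. *Termination.* If a correct user launches a bulk close listing $seq$, or any user proposes COMMIT for $seq$, then every correct user in $Q$ eventually decides COMMIT or ABORT for $seq$. A bulk close launched by a correct user, proposed for COMMIT by any user, or committed by a correct user lists exactly one sequence;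 and if a correct user decides COMMIT for $seq$, then some user proposed COMMIT for $seq$, and its bulk close is eventually written in $\Omega$, in the view of every correct user. 3. *Agreement.* No correct users decide COMMIT for two different sequences (neither one user nor two). 4. *ABORT-Validity.* If a correct user proposes ABORT for $seq$, then all correct users in $Q$ decide ABORT for $seq$. The same holds for a bulk close that lists no sequence. 5. *COMMIT-Validity.* If some user proposes COMMIT for $seq$ and no correct user proposes ABORT for $seq$, then all correct users in $Q$ decide COMMIT for $seq$. 6. *COMMIT-Privacy/Lightness.* Suppose that a correct user decides COMMIT for $seq=s_1s_2$, and let $TR^-$ be the minimal transfer set of the part $s_2$: for each coin, the single transfer from its owner before $s_2$ to its owner after $s_2$ (for $s_1$ empty: the minimal transfer set of $seq$). Then the transfers in $\Psi$ that a correct user $p\in P\setminus Q$, knowing the owners before $s_2$, learns from what it stores of $\Psi$, from messages sent to it by correct users and from what it stores of $\Omega$ after the last abort transaction there (if there is none: from all of $\Omega$) are at all times contained in $TR^-$, and from some time on they are exactly $TR^-$. -/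

import Mathlib

open scoped Classical

noncomputable section

namespace Platypus

/-! ### Data: transfers, transactions, messages

One instance of the protocol (one chain identifier) is followed.  The users of the parentchain are
the elements of a finite type `P`; `Acct` is the type of accounts and `Coin` the type of coins. -/

/-- The transfer of a coin from the account `src` to the account `dst`. -/
structure Transfer (Acct Coin : Type*) where
  coin : Coin
  src : Acct
  dst : Acct

/-- Ownership of the coins held in the childchain (`none`: the coin is not in the childchain). -/
abbrev Owners (Acct Coin : Type*) := Coin → Option Acct

/-- A message asking to join the childchain: the sender, the coins it deposits, and whether it
volunteers as a validator or joins as a mere user. -/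
structure Join (P Coin : Type*) where
  sender : P
  coins : Finset Coin
  validator : Bool

/-- Content of a creation transaction: the join messages it is built from, and the initial
ownership of the deposited coins. -/
structure CreateTx (P Acct Coin : Type*) where
  joins : Finset (Join P Coin)
  balances : Owners Acct Coin

/-- An abort transaction against the bulk close with ownership `claims` signed by `signers`.
`spend` is a payment recorded in the childchain block of height `height`, by which an account
named as an owner in `claims` has given the coin away; `cert` is a set of validators attesting that
record; `fraudsters` lists, for each block from that height on, validators that validated both the
block and the bulk close. -/
structure AbortTx (P Acct Coin : Type*) where
  claims : Owners Acct Coin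
  signers : Finset P
  height : ℕ
  fraudsters : List (Finset P)
  spend : Transfer Acct Coin
  cert : Finset P

/-- Transactions of the childchain. -/
inductive ChildTx (P Acct Coin : Type*) where
  | pay (tr : Transfer Acct Coin)
  | close (claims : Owners Acct Coin) (signers : Finset P)
  | abort (ab : AbortTx P Acct Coin)

/-- Transactions of the parentchain.  `close claims signers cert` is a bulk close together with the
set `cert` of validators attesting that it is written in the childchain. -/
inductive ParentTx (P Acct Coin : Type*) where
  | pay (tr : Transfer Acct Coin)
  | create (ct : CreateTx P Acct Coin) (signers : Finset P)
  | close (claims : Owners Acct Coin) (signers cert : Finset P)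
  | abort (ab : AbortTx P Acct Coin)

/-- Statements that a user can sign. -/
inductive Stmt (P Acct Coin : Type*) where
  | join (j : Join P Coin)
  | create (ct : CreateTx P Acct Coin)
  | close (claims : Owners Acct Coin)
  | payChild (tr : Transfer Acct Coin)
  | payParent (tr : Transfer Acct Coin)

/-- Messages of the protocol. -/
inductive Msg (P Acct Coin : Type*) where
  | join (j : Join P Coin)
  | createReq (ct : CreateTx P Acct Coin) (signers : Finset P)
  | closeReq (claims : Owners Acct Coin) (signers : Finset P)

inductive Verdict where
  | commit
  | abort

variable {P Acct Coin : Type*}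

/-- The senders of a set of join messages. -/
def senders (js : Finset (Join P Coin)) : Finset P := js.image Join.sender

/-- The senders that volunteer as validators. -/
def volunteers (js : Finset (Join P Coin)) : Finset P :=
  (js.filter (fun j => j.validator = true)).image Join.sender

/-- Users of the childchain. -/
def CreateTx.members (ct : CreateTx P Acct Coin) : Finset P := senders ct.joins

/-- Validators of the childchain. -/
def CreateTx.validators (ct : CreateTx P Acct Coin) : Finset P := volunteers ct.joins

/-- The number of signatures required from `n` validators. -/
def threshold (n : ℕ) : ℕ := 2 * n / 3 + 1

/-- `S` contains enough validators of the childchain created by `ct`. -/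
def Quorum (ct : CreateTx P Acct Coin) (S : Finset P) : Prop :=
  threshold ct.validators.card ≤ (S ∩ ct.validators).card

/-! ### Parameters -/

/-- The parameters of a run: who controls each account, who owns each coin on the parentchain
at the outset, the corrupted users, the validators of the parentchain, the number of validators
required for the childchain, and the user who launches the creation. -/
structure Setup (P Acct Coin : Type*) where
  ctrl : Acct → P
  genesis : Coin → Acct
  byz : Finset P
  parentValidators : Finset P
  mv : ℕ
  initiator : P

/-! ### Contents and validity rules of the two chains -/

/-- The payments in a childchain history, in order. -/
def transfers (H : List (ChildTx P Acct Coin)) : List (Transfer Acct Coin) :=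
  H.filterMap (fun x => match x with
    | ChildTx.pay tr => some tr
    | _ => none)

/-- Ownership after a sequence of transfers. -/
def ownersAfter (base : Owners Acct Coin) (seq : List (Transfer Acct Coin)) : Owners Acct Coin :=
  seq.foldl (fun o tr => Function.update o tr.coin (some tr.dst)) base

/-- The minimal transfer set of `seq`, starting from the ownership `base`: one transfer for each
coin, from its owner before `seq` to its owner after `seq`. -/
def minimalTransfers (base : Owners Acct Coin) (seq : List (Transfer Acct Coin)) :
    Set (Transfer Acct Coin) :=
  {tr | base tr.coin = some tr.src ∧ ownersAfter base seq tr.coin = some tr.dst}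

/-- Validity of a childchain transaction after the history `H`.  A payment spends a coin of its
current owner, in favour of an account of a user of the childchain which has not held that coin in
the childchain before, and only as long as no bulk close is written.  A bulk close has enough
signatures and lists the current owners, and at most one is written.  An abort transaction exhibits
a payment by which an owner named in the bulk close gave the coin away. -/
def childValid (G : Setup P Acct Coin) (ct : CreateTx P Acct Coin)
    (H : List (ChildTx P Acct Coin)) : ChildTx P Acct Coin → Prop
  | ChildTx.pay tr =>
      (∀ cl S, ChildTx.close cl S ∉ H) ∧
      ownersAfter ct.balances (transfers H) tr.coin = some tr.src ∧
      ct.balances tr.coin ≠ some tr.dst ∧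
      (∀ tr' ∈ transfers H, tr'.coin = tr.coin → tr'.dst ≠ tr.dst) ∧
      G.ctrl tr.dst ∈ ct.members
  | ChildTx.close cl S =>
      (∀ cl' S', ChildTx.close cl' S' ∉ H) ∧ Quorum ct S ∧
      cl = ownersAfter ct.balances (transfers H)
  | ChildTx.abort ab =>
      ChildTx.pay ab.spend ∈ H ∧ ab.claims ab.spend.coin = some ab.spend.src

/-- The creation transaction recorded in a parentchain history, if any. -/
def creation (H : List (ParentTx P Acct Coin)) : Option (CreateTx P Acct Coin) :=
  (H.filterMap (fun x => match x with
    | ParentTx.create ct _ => some ct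
    | _ => none)).head?

/-- A bulk close is recorded in the parentchain history. -/
def Closed (H : List (ParentTx P Acct Coin)) : Prop :=
  ∃ cl S T, ParentTx.close cl S T ∈ H

/-- Owner of a coin on the parentchain. -/
def parentOwner (G : Setup P Acct Coin) (H : List (ParentTx P Acct Coin)) : Coin → Acct :=
  H.foldl (fun o x => match x with
    | ParentTx.pay tr => Function.update o tr.coin tr.dst
    | ParentTx.close cl _ _ => fun c => (cl c).getD (o c)
    | _ => o) G.genesis

/-- Coins deposited in the childchain are locked on the parentchain until the bulk close. -/
def Locked (H : List (ParentTx P Acct Coin)) (c : Coin) : Prop :=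
  ∃ ct, creation H = some ct ∧ ct.balances c ≠ none ∧ ¬ Closed H

/-- The sender of a join message owns the coins it deposits. -/
def JoinOK (G : Setup P Acct Coin) (H : List (ParentTx P Acct Coin)) (j : Join P Coin) : Prop :=
  ∀ c ∈ j.coins, G.ctrl (parentOwner G H c) = j.sender

/-- The balances of a set of depositors. -/
def balancesOf (G : Setup P Acct Coin) (H : List (ParentTx P Acct Coin))
    (js : Finset (Join P Coin)) : Owners Acct Coin :=
  fun c => if ∃ j ∈ js, c ∈ j.coins then some (parentOwner G H c) else none

/-- The deposits of a creation transaction are available and its balances are right. -/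
def FundsOK (G : Setup P Acct Coin) (H : List (ParentTx P Acct Coin))
    (ct : CreateTx P Acct Coin) : Prop :=
  (∀ j ∈ ct.joins, JoinOK G H j) ∧ ct.balances = balancesOf G H ct.joins

/-- What a validator verifies before signing a creation transaction. -/
def VerifyCreate (G : Setup P Acct Coin) (H : List (ParentTx P Acct Coin))
    (ct : CreateTx P Acct Coin) : Prop :=
  ct.validators.card = G.mv ∧
  (∀ j ∈ ct.joins, ∀ j' ∈ ct.joins, j.sender = j'.sender → j = j') ∧
  FundsOK G H ct

/-- Validity of a parentchain transaction after the history `H`.  The parentchain does not see the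
childchain: it checks a bulk close and a proof of fraud through the signatures they carry. -/
def parentValid (G : Setup P Acct Coin) (H : List (ParentTx P Acct Coin)) :
    ParentTx P Acct Coin → Prop
  | ParentTx.pay tr => ¬ Locked H tr.coin ∧ parentOwner G H tr.coin = tr.src
  | ParentTx.create ct S =>
      creation H = none ∧ threshold G.mv ≤ (S ∩ ct.validators).card ∧ FundsOK G H ct
  | ParentTx.close _ S T =>
      ¬ Closed H ∧ ∃ ct, creation H = some ct ∧ Quorum ct S ∧ Quorum ct T
  | ParentTx.abort ab =>
      ¬ Closed H ∧ (∃ ct, creation H = some ct ∧ Quorum ct ab.cert) ∧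
      ab.claims ab.spend.coin = some ab.spend.src

/-! ### Global states -/

/-- Global state of the system.  Local components are meaningful for correct users only. -/
structure State (P Acct Coin : Type*) where
  /-- statements signed so far by each correct user -/
  signed : P → Set (Stmt P Acct Coin)
  /-- messages sent so far by correct users, with their destinations -/
  sent : Set (P × Msg P Acct Coin)
  /-- messages received so far by each user -/
  rcvd : P → Set (Msg P Acct Coin)
  /-- join messages gathered by each volunteer -/
  joined : P → Finset (Join P Coin)
  /-- the blocks of the parentchain decided by each user -/
  parent : P → List (List (ParentTx P Acct Coin))
  /-- the blocks of the childchain decided by each user -/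
  child : P → List (List (ChildTx P Acct Coin))
  /-- transactions sent to the parentchain, with the user who sent them -/
  parentPool : Set (P × ParentTx P Acct Coin)
  /-- transactions sent to the childchain, with the user who sent them -/
  childPool : Set (P × ChildTx P Acct Coin)
  /-- bulk closes launched by correct users -/
  started : Set (P × Owners Acct Coin)
  /-- decisions of correct users -/
  decided : P → Set (Verdict × Owners Acct Coin)

/-- Initial state: nothing has happened. -/
def State.start : State P Acct Coin where
  signed := fun _ => ∅
  sent := ∅
  rcvd := fun _ => ∅
  joined := fun _ => ∅
  parent := fun _ => []
  child := fun _ => []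
  parentPool := ∅
  childPool := ∅
  started := ∅
  decided := fun _ => ∅

/-- Parentchain history known to `p`. -/
def State.parentLog (s : State P Acct Coin) (p : P) : List (ParentTx P Acct Coin) :=
  (s.parent p).flatten

/-- Childchain history known to `p`. -/
def State.childLog (s : State P Acct Coin) (p : P) : List (ChildTx P Acct Coin) :=
  (s.child p).flatten

/-- `p` adds its signature to a statement. -/
def State.sign (s : State P Acct Coin) (p : P) (x : Stmt P Acct Coin) : State P Acct Coin :=
  { s with signed := Function.update s.signed p (insert x (s.signed p)) }

/-- A correct user sends a message to all users in `V`. -/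
def State.multicast (s : State P Acct Coin) (V : Set P) (m : Msg P Acct Coin) :
    State P Acct Coin :=
  { s with sent := s.sent ∪ {x | x.1 ∈ V ∧ x.2 = m} }

/-- `p` sends a transaction to the parentchain. -/
def State.toParent (s : State P Acct Coin) (p : P) (x : ParentTx P Acct Coin) :
    State P Acct Coin :=
  { s with parentPool := insert (p, x) s.parentPool }

/-- `p` sends a transaction to the childchain. -/
def State.toChild (s : State P Acct Coin) (p : P) (x : ChildTx P Acct Coin) :
    State P Acct Coin :=
  { s with childPool := insert (p, x) s.childPool }

/-- `p` decides. -/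
def State.decide (s : State P Acct Coin) (p : P) (v : Verdict) (cl : Owners Acct Coin) :
    State P Acct Coin :=
  { s with decided := Function.update s.decided p (insert (v, cl) (s.decided p)) }

/-! ### Signatures cannot be forged

A set of signatures can exist only if its correct members have produced theirs. A validator of the
childchain attests what is recorded in the blocks that it has decided. -/

/-- Every correct member of `S` has signed `x`. -/
def SignedBy (G : Setup P Acct Coin) (s : State P Acct Coin) (x : Stmt P Acct Coin)
    (S : Finset P) : Prop :=
  ∀ q ∈ S, q ∉ G.byz → x ∈ s.signed q

/-- Every correct member of `S` has decided a childchain with `x` recorded in it. -/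
def Attested (G : Setup P Acct Coin) (s : State P Acct Coin) (x : ChildTx P Acct Coin)
    (S : Finset P) : Prop :=
  ∀ q ∈ S, q ∉ G.byz → x ∈ s.childLog q

/-- Every correct member of `S` has decided a childchain with `x` recorded at height `h`. -/
def AttestedAt (G : Setup P Acct Coin) (s : State P Acct Coin) (h : ℕ) (x : ChildTx P Acct Coin)
    (S : Finset P) : Prop :=
  ∀ q ∈ S, q ∉ G.byz → ∃ b, (s.child q)[h]? = some b ∧ x ∈ b

/-- The signatures of a join message exist. -/
def AuthJoin (G : Setup P Acct Coin) (s : State P Acct Coin) (j : Join P Coin) : Prop :=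
  SignedBy G s (Stmt.join j) {j.sender}

/-- The signatures of a creation transaction exist. -/
def AuthCreate (G : Setup P Acct Coin) (s : State P Acct Coin) (ct : CreateTx P Acct Coin)
    (S : Finset P) : Prop :=
  (∀ j ∈ ct.joins, AuthJoin G s j) ∧ SignedBy G s (Stmt.create ct) S

/-- The signatures of an abort transaction exist. -/
def AuthAbort (G : Setup P Acct Coin) (s : State P Acct Coin) (ab : AbortTx P Acct Coin) : Prop :=
  SignedBy G s (Stmt.close ab.claims) ab.signers ∧
  AttestedAt G s ab.height (ChildTx.pay ab.spend) ab.cert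

/-- The signatures in a message exist. -/
def AuthMsg (G : Setup P Acct Coin) (s : State P Acct Coin) : Msg P Acct Coin → Prop
  | Msg.join j => AuthJoin G s j
  | Msg.createReq ct S => AuthCreate G s ct S
  | Msg.closeReq cl S => SignedBy G s (Stmt.close cl) S

/-- The signatures in a childchain transaction exist. -/
def AuthChildTx (G : Setup P Acct Coin) (s : State P Acct Coin) : ChildTx P Acct Coin → Prop
  | ChildTx.pay tr => SignedBy G s (Stmt.payChild tr) {G.ctrl tr.src}
  | ChildTx.close cl S => SignedBy G s (Stmt.close cl) S
  | ChildTx.abort ab => AuthAbort G s ab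

/-- The signatures in a parentchain transaction exist. -/
def AuthParentTx (G : Setup P Acct Coin) (s : State P Acct Coin) : ParentTx P Acct Coin → Prop
  | ParentTx.pay tr => SignedBy G s (Stmt.payParent tr) {G.ctrl tr.src}
  | ParentTx.create ct S => AuthCreate G s ct S
  | ParentTx.close cl S T =>
      SignedBy G s (Stmt.close cl) S ∧ Attested G s (ChildTx.close cl S) T
  | ParentTx.abort ab => AuthAbort G s ab

/-! ### The creation procedure -/

/-- `p` has joined as a validator. -/
def Volunteered (s : State P Acct Coin) (p : P) : Prop :=
  ∃ j : Join P Coin, j.sender = p ∧ j.validator = true ∧ Stmt.join j ∈ s.signed p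

/-- Phases 1 and 2: the initiator sends a join message, the others may reply to it; only once. -/
def JoinEnabled (G : Setup P Acct Coin) (s : State P Acct Coin) (p : P) (j : Join P Coin) : Prop :=
  j.sender = p ∧ (∀ j', Stmt.join j' ∉ s.signed p) ∧
  (p = G.initiator ∨ ∃ j', j'.sender = G.initiator ∧ Msg.join j' ∈ s.rcvd p) ∧
  JoinOK G (s.parentLog p) j

/-- Phase 3: a volunteer gathers the join messages of distinct users. -/
def GatherEnabled (G : Setup P Acct Coin) (s : State P Acct Coin) (p : P) (j : Join P Coin) :
    Prop :=
  Volunteered s p ∧ Msg.join j ∈ s.rcvd p ∧ JoinOK G (s.parentLog p) j ∧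
  ∀ j' ∈ s.joined p, j'.sender ≠ j.sender

/-- The creation transaction that `p` builds from the join messages it has gathered. -/
def mkCreate (G : Setup P Acct Coin) (s : State P Acct Coin) (p : P) : CreateTx P Acct Coin where
  joins := s.joined p
  balances := balancesOf G (s.parentLog p) (s.joined p)

/-- `p` adds `j` to the join messages it has gathered. -/
def State.addJoin (s : State P Acct Coin) (p : P) (j : Join P Coin) : State P Acct Coin :=
  { s with joined := Function.update s.joined p (insert j (s.joined p)) }

/-- Phase 3, effect: if `j` completes the required number of validators, the creation transaction
is built, signed, and multicast to the validators. -/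
def gather (G : Setup P Acct Coin) (s : State P Acct Coin) (p : P) (j : Join P Coin) :
    State P Acct Coin :=
  let s' := s.addJoin p j
  let ct := mkCreate G s' p
  if j.validator = true ∧ ct.validators.card = G.mv then
    (s'.sign p (Stmt.create ct)).multicast (ct.validators : Set P) (Msg.createReq ct {p})
  else s'

/-- Phase 4: a validator has received a creation transaction and verified it. -/
def SignCreateEnabled (G : Setup P Acct Coin) (s : State P Acct Coin) (p : P)
    (ct : CreateTx P Acct Coin) (S : Finset P) : Prop :=
  p ∈ ct.validators ∧ Msg.createReq ct S ∈ s.rcvd p ∧ creation (s.parentLog p) = none ∧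
  VerifyCreate G (s.parentLog p) ct

/-- Phase 4, effect: sign; multicast, or send to the parentchain if there are enough signatures. -/
def signCreate (G : Setup P Acct Coin) (s : State P Acct Coin) (p : P)
    (ct : CreateTx P Acct Coin) (S : Finset P) : State P Acct Coin :=
  let s' := s.sign p (Stmt.create ct)
  if (insert p S ∩ ct.validators).card < threshold G.mv then
    s'.multicast (ct.validators : Set P) (Msg.createReq ct (insert p S))
  else s'.toParent p (ParentTx.create ct (insert p S))

/-- The effect of phase 4 has taken place. -/
def SignCreateDone (G : Setup P Acct Coin) (s : State P Acct Coin) (p : P)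
    (ct : CreateTx P Acct Coin) (S : Finset P) : Prop :=
  if (insert p S ∩ ct.validators).card < threshold G.mv then
    ∀ v ∈ ct.validators, (v, Msg.createReq ct (insert p S)) ∈ s.sent
  else (p, ParentTx.create ct (insert p S)) ∈ s.parentPool

/-! ### The bulk close procedure -/

/-- `p` sees the childchain `ct` created in the parentchain and is one of its users. -/
def InChild (s : State P Acct Coin) (p : P) (ct : CreateTx P Acct Coin) : Prop :=
  creation (s.parentLog p) = some ct ∧ p ∈ ct.members

/-- The current owners of the coins, as `p` sees them. -/
def currentOwners (s : State P Acct Coin) (p : P) (ct : CreateTx P Acct Coin) :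
    Owners Acct Coin :=
  ownersAfter ct.balances (transfers (s.childLog p))

/-- Phase 1: `p` creates a bulk close, signs it and multicasts it to the validators. -/
def startClose (s : State P Acct Coin) (p : P) (ct : CreateTx P Acct Coin) : State P Acct Coin :=
  let cl := currentOwners s p ct
  let s' := (s.sign p (Stmt.close cl)).multicast (ct.validators : Set P) (Msg.closeReq cl {p})
  { s' with started := insert (p, cl) s'.started }

/-- Phase 2: a validator has received a bulk close, not yet written in the childchain, and verified
that it lists the current owners. -/
def SignCloseEnabled (s : State P Acct Coin) (p : P) (ct : CreateTx P Acct Coin)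
    (cl : Owners Acct Coin) (S : Finset P) : Prop :=
  InChild s p ct ∧ p ∈ ct.validators ∧ Msg.closeReq cl S ∈ s.rcvd p ∧
  (∀ S', ChildTx.close cl S' ∉ s.childLog p) ∧ cl = currentOwners s p ct

/-- Phase 2, effect: sign; multicast, or send to the childchain if there are enough signatures. -/
def signClose (s : State P Acct Coin) (p : P) (ct : CreateTx P Acct Coin)
    (cl : Owners Acct Coin) (S : Finset P) : State P Acct Coin :=
  let s' := s.sign p (Stmt.close cl)
  if Quorum ct (insert p S) then s'.toChild p (ChildTx.close cl (insert p S))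
  else s'.multicast (ct.validators : Set P) (Msg.closeReq cl (insert p S))

/-- The effect of phase 2 has taken place. -/
def SignCloseDone (s : State P Acct Coin) (p : P) (ct : CreateTx P Acct Coin)
    (cl : Owners Acct Coin) (S : Finset P) : Prop :=
  if Quorum ct (insert p S) then (p, ChildTx.close cl (insert p S)) ∈ s.childPool
  else ∀ v ∈ ct.validators, (v, Msg.closeReq cl (insert p S)) ∈ s.sent

/-- Phase 3: the childchain responds that the bulk close is written, with an attestation `T`. -/
def CommitEnabled (G : Setup P Acct Coin) (s : State P Acct Coin) (p : P)
    (ct : CreateTx P Acct Coin) (cl : Owners Acct Coin) (S T : Finset P) : Prop :=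
  InChild s p ct ∧ ChildTx.close cl S ∈ s.childLog p ∧
  Quorum ct T ∧ Attested G s (ChildTx.close cl S) T

/-- Phase 3: the childchain responds that an abort transaction is written. -/
def AbortDecisionEnabled (s : State P Acct Coin) (p : P) (ct : CreateTx P Acct Coin)
    (ab : AbortTx P Acct Coin) : Prop :=
  InChild s p ct ∧ ChildTx.abort ab ∈ s.childLog p

/-! ### The abort procedure -/

/-- `ab` is an abort transaction that `p` can build against the bulk close `cl` signed by `S`: some
coin in `cl` is spent in the childchain by its alleged owner, `ab.height` is the least height of a
block showing this, and the validators listed as fraudsters validated both the bulk close and the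
respective block. -/
def AbortFor (G : Setup P Acct Coin) (s : State P Acct Coin) (p : P) (ct : CreateTx P Acct Coin)
    (cl : Owners Acct Coin) (S : Finset P) (ab : AbortTx P Acct Coin) : Prop :=
  ab.claims = cl ∧ ab.signers = S ∧
  cl ab.spend.coin = some ab.spend.src ∧
  (∃ b, (s.child p)[ab.height]? = some b ∧ ChildTx.pay ab.spend ∈ b) ∧
  (∀ h < ab.height, ∀ b, (s.child p)[h]? = some b →
    ∀ tr, ChildTx.pay tr ∈ b → cl tr.coin ≠ some tr.src) ∧
  Quorum ct ab.cert ∧ AttestedAt G s ab.height (ChildTx.pay ab.spend) ab.cert ∧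
  ab.fraudsters.length = (s.child p).length - ab.height ∧
  ∀ (k : ℕ) (F : Finset P) (b : List (ChildTx P Acct Coin)),
    ab.fraudsters[k]? = some F → (s.child p)[ab.height + k]? = some b →
    F ⊆ ct.validators ∩ S ∧ ∀ q ∈ F, q ∉ G.byz → (s.child q)[ab.height + k]? = some b

/-- A user of the childchain has received a bulk close in which coins are spent, and can build the
abort transaction `ab`. -/
def AbortEnabled (G : Setup P Acct Coin) (s : State P Acct Coin) (p : P)
    (ct : CreateTx P Acct Coin) (cl : Owners Acct Coin) (S : Finset P)
    (ab : AbortTx P Acct Coin) : Prop :=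
  InChild s p ct ∧ Msg.closeReq cl S ∈ s.rcvd p ∧ AbortFor G s p ct cl S ab

/-- An abort transaction of `p` against `cl` has been sent to both chains. -/
def AbortDone (s : State P Acct Coin) (p : P) (cl : Owners Acct Coin) : Prop :=
  ∃ ab : AbortTx P Acct Coin, ab.claims = cl ∧
    (p, ParentTx.abort ab) ∈ s.parentPool ∧ (p, ChildTx.abort ab) ∈ s.childPool

/-! ### Executions -/

/-- One step of the system: a step of a correct user, a block decided by a correct user, the
delivery of a message, or an action of the adversary, who can send any message and any transaction
whose signatures exist. -/
inductive Step (G : Setup P Acct Coin) (s : State P Acct Coin) : State P Acct Coin → Prop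
  | idle : Step G s s
  | join (p : P) (j : Join P Coin) : p ∉ G.byz → JoinEnabled G s p j →
      Step G s ((s.sign p (Stmt.join j)).multicast Set.univ (Msg.join j))
  | gather (p : P) (j : Join P Coin) : p ∉ G.byz → GatherEnabled G s p j →
      Step G s (gather G s p j)
  | signCreate (p : P) (ct : CreateTx P Acct Coin) (S : Finset P) : p ∉ G.byz →
      SignCreateEnabled G s p ct S → Step G s (signCreate G s p ct S)
  | payParent (p : P) (tr : Transfer Acct Coin) : p ∉ G.byz → G.ctrl tr.src = p →
      parentOwner G (s.parentLog p) tr.coin = tr.src →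
      Step G s ((s.sign p (Stmt.payParent tr)).toParent p (ParentTx.pay tr))
  | payChild (p : P) (ct : CreateTx P Acct Coin) (tr : Transfer Acct Coin) : p ∉ G.byz →
      InChild s p ct → G.ctrl tr.src = p → currentOwners s p ct tr.coin = some tr.src →
      Step G s ((s.sign p (Stmt.payChild tr)).toChild p (ChildTx.pay tr))
  | startClose (p : P) (ct : CreateTx P Acct Coin) : p ∉ G.byz → InChild s p ct →
      Step G s (startClose s p ct)
  | signClose (p : P) (ct : CreateTx P Acct Coin) (cl : Owners Acct Coin) (S : Finset P) :
      p ∉ G.byz → SignCloseEnabled s p ct cl S → Step G s (signClose s p ct cl S)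
  | abort (p : P) (ct : CreateTx P Acct Coin) (cl : Owners Acct Coin) (S : Finset P)
      (ab : AbortTx P Acct Coin) : p ∉ G.byz → AbortEnabled G s p ct cl S ab →
      Step G s ((s.toParent p (ParentTx.abort ab)).toChild p (ChildTx.abort ab))
  | decideCommit (p : P) (ct : CreateTx P Acct Coin) (cl : Owners Acct Coin) (S T : Finset P) :
      p ∉ G.byz → CommitEnabled G s p ct cl S T →
      Step G s ((s.decide p Verdict.commit cl).toParent p (ParentTx.close cl S T))
  | decideAbort (p : P) (ct : CreateTx P Acct Coin) (ab : AbortTx P Acct Coin) : p ∉ G.byz →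
      AbortDecisionEnabled s p ct ab →
      Step G s ((s.decide p Verdict.abort ab.claims).toParent p (ParentTx.abort ab))
  | parentBlock (p : P) (b : List (ParentTx P Acct Coin)) : p ∉ G.byz →
      Step G s { s with parent := Function.update s.parent p (s.parent p ++ [b]) }
  | childBlock (p : P) (ct : CreateTx P Acct Coin) (b : List (ChildTx P Acct Coin)) :
      p ∉ G.byz → InChild s p ct →
      Step G s { s with child := Function.update s.child p (s.child p ++ [b]) }
  | deliver (q : P) (m : Msg P Acct Coin) : (q, m) ∈ s.sent →
      Step G s { s with rcvd := Function.update s.rcvd q (insert m (s.rcvd q)) }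
  | byzMsg (z q : P) (m : Msg P Acct Coin) : z ∈ G.byz → AuthMsg G s m →
      Step G s { s with rcvd := Function.update s.rcvd q (insert m (s.rcvd q)) }
  | byzParent (z : P) (x : ParentTx P Acct Coin) : z ∈ G.byz → AuthParentTx G s x →
      Step G s (s.toParent z x)
  | byzChild (z : P) (x : ChildTx P Acct Coin) : z ∈ G.byz → AuthChildTx G s x →
      Step G s (s.toChild z x)

/-- Correct users do not stop: whenever a rule of the protocol stays enabled, it is applied. -/
structure Fair (G : Setup P Acct Coin) (E : ℕ → State P Acct Coin) : Prop where
  gather : ∀ p ∉ G.byz, ∀ j t, ∃ t' ≥ t, ¬ GatherEnabled G (E t') p j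
  signCreate : ∀ p ∉ G.byz, ∀ ct S t, ∃ t' ≥ t,
    SignCreateEnabled G (E t') p ct S → SignCreateDone G (E t') p ct S
  signClose : ∀ p ∉ G.byz, ∀ ct cl S t, ∃ t' ≥ t,
    SignCloseEnabled (E t') p ct cl S → SignCloseDone (E t') p ct cl S
  abort : ∀ p ∉ G.byz, ∀ ct cl S t, ∃ t' ≥ t,
    (∃ ab, AbortEnabled G (E t') p ct cl S ab) → AbortDone (E t') p cl
  decideCommit : ∀ p ∉ G.byz, ∀ ct cl t, ∃ t' ≥ t,
    (∃ S T, CommitEnabled G (E t') p ct cl S T) → (Verdict.commit, cl) ∈ (E t').decided p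
  decideAbort : ∀ p ∉ G.byz, ∀ ct ab t, ∃ t' ≥ t,
    AbortDecisionEnabled (E t') p ct ab → (Verdict.abort, ab.claims) ∈ (E t').decided p

/-- An execution of the protocol. -/
structure Execution (G : Setup P Acct Coin) (E : ℕ → State P Acct Coin) : Prop where
  start : E 0 = State.start
  step : ∀ t, Step G (E t) (E (t + 1))
  fair : Fair G E

/-- Partial synchrony: if `τ i` is the time of step `i`, there are an unknown stabilization time
`GST` and an unknown bound `Δ` such that a message sent by a correct user to a correct user at time
`τ i` is delivered by the time `max (τ i) GST + Δ`. -/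
def PartialSynchrony (G : Setup P Acct Coin) (E : ℕ → State P Acct Coin) : Prop :=
  ∃ τ : ℕ → ℝ, Monotone τ ∧ Filter.Tendsto τ Filter.atTop Filter.atTop ∧
    ∃ GST Δ : ℝ, 0 ≤ Δ ∧ ∀ (i : ℕ) (q : P) (m : Msg P Acct Coin), q ∉ G.byz →
      (q, m) ∈ (E i).sent → ∀ j, max (τ i) GST + Δ < τ j → m ∈ (E j).rcvd q

/-- All transactions of a list are valid after the history `H` and the preceding ones. -/
def ValidFrom {Tx : Type*} (valid : List Tx → Tx → Prop) : List Tx → List Tx → Prop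
  | _, [] => True
  | H, x :: xs => valid H x ∧ ValidFrom valid (H ++ [x]) xs

/-- A chain built block by block on a Byzantine fault tolerant consensus that does not fork.
`members` are the users of the chain, `V` its validators, `log t p` the blocks decided by `p` up to
step `t`, `pool t` the transactions sent to the chain.  If less than a third of the validators are
Byzantine, then at every height no two correct users decide different blocks, what is decided is
valid and was sent to the chain, if one correct user decides at some height then all do, and a
transaction of a correct user that remains valid is written. -/
def UnforkableBFT {Tx : Type*} (byz V members : Finset P) (log : ℕ → P → List (List Tx))
    (pool : ℕ → Set (P × Tx)) (valid : List Tx → Tx → Prop) : Prop :=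
  3 * (byz ∩ V).card < V.card →
    (∀ p ∈ members \ byz, ∀ q ∈ members \ byz, ∀ (t t' h : ℕ) (b b' : List Tx),
      (log t p)[h]? = some b → (log t' q)[h]? = some b' → b = b') ∧
    (∀ p ∈ members \ byz, ∀ t, ValidFrom valid [] (log t p).flatten ∧
      ∀ x ∈ (log t p).flatten, ∃ r, (r, x) ∈ pool t) ∧
    (∀ p ∈ members \ byz, ∀ q ∈ members \ byz, ∀ t h,
      h < (log t p).length → ∃ t', h < (log t' q).length) ∧
    (∀ p ∉ byz, ∀ t x, (p, x) ∈ pool t →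
      (∃ t₀, ∀ t' ≥ t₀, ∀ q ∈ members \ byz,
        x ∈ (log t' q).flatten ∨ valid (log t' q).flatten x) →
      ∃ t', ∃ q ∈ members \ byz, x ∈ (log t' q).flatten)

/-- The childchain `ct` is created: its creation transaction is written in the parentchain. -/
def Created (G : Setup P Acct Coin) (E : ℕ → State P Acct Coin) (ct : CreateTx P Acct Coin) :
    Prop :=
  ∃ t, ∃ p ∉ G.byz, creation ((E t).parentLog p) = some ct

/-- The parentchain is an unforkable Byzantine fault tolerant chain. -/
def ParentBFT [Fintype P] (G : Setup P Acct Coin) (E : ℕ → State P Acct Coin) : Prop :=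
  UnforkableBFT G.byz G.parentValidators Finset.univ (fun t => (E t).parent)
    (fun t => (E t).parentPool) (parentValid G)

/-- The childchain run by the validators named in its creation transaction is an unforkable
Byzantine fault tolerant chain. -/
def ChildBFT (G : Setup P Acct Coin) (E : ℕ → State P Acct Coin) : Prop :=
  ∀ ct, Created G E ct →
    UnforkableBFT G.byz ct.validators ct.members (fun t => (E t).child)
      (fun t => (E t).childPool) (childValid G ct)

/-! ### The offchain problem -/

/-- The bulk close `cl` lists the sequence `seq` of transfers made in the childchain: `seq` is what
is recorded in the childchain up to some point, and leads to the owners named in `cl`. -/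
def Lists (G : Setup P Acct Coin) (E : ℕ → State P Acct Coin) (ct : CreateTx P Acct Coin)
    (cl : Owners Acct Coin) (seq : List (Transfer Acct Coin)) : Prop :=
  (∃ t, ∃ q ∈ ct.members \ G.byz, seq <+: transfers ((E t).childLog q)) ∧
  cl = ownersAfter ct.balances seq

/-- `p` launches the bulk close `cl`. -/
def Launches (E : ℕ → State P Acct Coin) (p : P) (cl : Owners Acct Coin) : Prop :=
  ∃ t, (p, cl) ∈ (E t).started

/-- `p` proposes COMMIT for `cl`: it sends the bulk close, with enough signatures, to the
childchain. -/
def ProposesCommit (E : ℕ → State P Acct Coin) (ct : CreateTx P Acct Coin) (p : P)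
    (cl : Owners Acct Coin) : Prop :=
  ∃ t S, Quorum ct S ∧ (p, ChildTx.close cl S) ∈ (E t).childPool

/-- `p` proposes ABORT for `cl`: it sends an abort transaction against it to the
childchain. -/
def ProposesAbort (E : ℕ → State P Acct Coin) (p : P) (cl : Owners Acct Coin) : Prop :=
  ∃ t, ∃ ab : AbortTx P Acct Coin, ab.claims = cl ∧
    (p, ChildTx.abort ab) ∈ (E t).childPool

/-- `p` decides the verdict `v` for `cl`. -/
def Decides (E : ℕ → State P Acct Coin) (p : P) (v : Verdict) (cl : Owners Acct Coin) : Prop :=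
  ∃ t, (v, cl) ∈ (E t).decided p

/-- A property of bulk closes, seen as a property of sequences of transfers. -/
def OnSeq (G : Setup P Acct Coin) (E : ℕ → State P Acct Coin) (ct : CreateTx P Acct Coin)
    (A : Owners Acct Coin → Prop) (seq : List (Transfer Acct Coin)) : Prop :=
  ∃ cl, Lists G E ct cl seq ∧ A cl

/-- The transfers shown by a bulk close to someone who knows the owners `base`. -/
def shown (base cl : Owners Acct Coin) : Set (Transfer Acct Coin) :=
  {tr | base tr.coin = some tr.src ∧ cl tr.coin = some tr.dst}

/-- The transfers in the childchain shown by a parentchain transaction to someone who knows the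
owners `base`. -/
def disclosed (base : Owners Acct Coin) : ParentTx P Acct Coin → Set (Transfer Acct Coin)
  | ParentTx.pay _ => ∅
  | ParentTx.create _ _ => ∅
  | ParentTx.close cl _ _ => shown base cl
  | ParentTx.abort ab => insert ab.spend (shown base ab.claims)

def isAbort : ParentTx P Acct Coin → Bool
  | ParentTx.abort _ => true
  | _ => false

/-- The parentchain transactions after the last abort transaction (all, if there is none). -/
def sinceLastAbort (H : List (ParentTx P Acct Coin)) : List (ParentTx P Acct Coin) :=
  H.rtakeWhile (fun x => !isAbort x)

/-- The transfers in the childchain that `p`, knowing the owners `base`, learns from what it stores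
of the childchain, from what correct users send to it, and from what it stores of the parentchain
since the last abort transaction. -/
def learned (base : Owners Acct Coin) (s : State P Acct Coin) (p : P) :
    Set (Transfer Acct Coin) :=
  {tr | ChildTx.pay tr ∈ s.childLog p} ∪
  {tr | ∃ cl S, (p, Msg.closeReq cl S) ∈ s.sent ∧ tr ∈ shown base cl} ∪
  {tr | ∃ x ∈ sinceLastAbort (s.parentLog p), tr ∈ disclosed base x}

/-- The execution solves the offchain problem for the childchain `ct`. -/
structure SolvesOffchain (G : Setup P Acct Coin) (E : ℕ → State P Acct Coin)
    (ct : CreateTx P Acct Coin) : Prop where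
  /-- A bulk close launched by a correct user, proposed by anybody or committed by a correct user
  lists exactly one sequence. -/
  lists_one : ∀ p cl, (p ∉ G.byz ∧ Launches E p cl) ∨ ProposesCommit E ct p cl ∨
    (p ∉ G.byz ∧ Decides E p Verdict.commit cl) → ∃! seq, Lists G E ct cl seq
  /-- Termination, after a correct user launched a bulk close. -/
  termination_launched : ∀ p ∉ G.byz, ∀ seq, OnSeq G E ct (Launches E p) seq →
    ∀ q ∈ ct.members \ G.byz,
      OnSeq G E ct (Decides E q Verdict.commit) seq ∨ OnSeq G E ct (Decides E q Verdict.abort) seq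
  /-- Termination, after any user proposed COMMIT. -/
  termination_proposed : ∀ p seq, OnSeq G E ct (ProposesCommit E ct p) seq →
    ∀ q ∈ ct.members \ G.byz,
      OnSeq G E ct (Decides E q Verdict.commit) seq ∨ OnSeq G E ct (Decides E q Verdict.abort) seq
  /-- A sequence committed by a correct user is one for which some user proposed COMMIT. -/
  commit_proposed : ∀ p ∉ G.byz, ∀ seq, OnSeq G E ct (Decides E p Verdict.commit) seq →
    ∃ r, OnSeq G E ct (ProposesCommit E ct r) seq
  /-- After a COMMIT the bulk close gets written in the parentchain. -/
  settlement : ∀ p ∉ G.byz, ∀ cl, Decides E p Verdict.commit cl → ∀ q ∉ G.byz,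
    ∃ t S T, ParentTx.close cl S T ∈ (E t).parentLog q
  /-- Agreement. -/
  agreement : ∀ p ∉ G.byz, ∀ q ∉ G.byz, ∀ seq seq',
    OnSeq G E ct (Decides E p Verdict.commit) seq →
    OnSeq G E ct (Decides E q Verdict.commit) seq' → seq = seq'
  /-- ABORT-Validity. -/
  abort_validity : ∀ p ∉ G.byz, ∀ seq, OnSeq G E ct (ProposesAbort E p) seq →
    ∀ q ∈ ct.members \ G.byz, OnSeq G E ct (Decides E q Verdict.abort) seq
  /-- ABORT-Validity, also for a bulk close that lists no sequence made in the childchain. -/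
  abort_validity_fraud : ∀ p ∉ G.byz, ∀ cl, ProposesAbort E p cl →
    ∀ q ∈ ct.members \ G.byz, Decides E q Verdict.abort cl
  /-- COMMIT-Validity. -/
  commit_validity : ∀ r seq, OnSeq G E ct (ProposesCommit E ct r) seq →
    (¬ ∃ p ∉ G.byz, OnSeq G E ct (ProposesAbort E p) seq) →
    ∀ q ∈ ct.members \ G.byz, OnSeq G E ct (Decides E q Verdict.commit) seq
  /-- COMMIT-Privacy/Lightness, for the time range of the final part `s₂` of the sequence: a correct
  user outside the childchain never learns more than the minimal transfers, and eventually learns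
  these. -/
  privacy : ∀ q ∉ G.byz, ∀ s₁ s₂, OnSeq G E ct (Decides E q Verdict.commit) (s₁ ++ s₂) →
    ∀ p ∉ G.byz, p ∉ ct.members →
      (∀ t, learned (ownersAfter ct.balances s₁) (E t) p ⊆
        minimalTransfers (ownersAfter ct.balances s₁) s₂) ∧
      ∃ t₀, ∀ t ≥ t₀, learned (ownersAfter ct.balances s₁) (E t) p =
        minimalTransfers (ownersAfter ct.balances s₁) s₂

/-- The childchain `ct` has the required number of validators, enough of them signed its creation,
and all its correct users asked to join as it records them. -/
structure Bootstrapped (G : Setup P Acct Coin) (E : ℕ → State P Acct Coin)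
    (ct : CreateTx P Acct Coin) : Prop where
  validators_card : ct.validators.card = G.mv
  signers : ∃ t S, threshold G.mv ≤ (S ∩ ct.validators).card ∧
    (∃ p ∉ G.byz, ParentTx.create ct S ∈ (E t).parentLog p) ∧ SignedBy G (E t) (Stmt.create ct) S
  explicit : ∀ j ∈ ct.joins, j.sender ∉ G.byz → ∃ t, Stmt.join j ∈ (E t).signed j.sender

/-- The creation terminates: if enough correct users volunteer as validators and nobody spends
on the parentchain a coin that it offers in a join message, the childchain is created. -/
def CreationTerminates (G : Setup P Acct Coin) (E : ℕ → State P Acct Coin) : Prop :=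
  (∃ W : Finset P, G.mv ≤ W.card ∧ ∀ w ∈ W, w ∉ G.byz ∧ ∃ t, Volunteered (E t) w) →
  (∀ t t', ∀ p ∉ G.byz, ∀ q ∉ G.byz, ∀ j tr, Msg.join j ∈ (E t).rcvd p → tr.coin ∈ j.coins →
    G.ctrl tr.src = j.sender → ParentTx.pay tr ∉ (E t').parentLog q) →
  ∃ ct, ∀ q ∉ G.byz, ∃ t, creation ((E t).parentLog q) = some ct

end Platypus

end

/-! ### Monotonicity of the global state. -/

namespace Platypus

variable {P Acct Coin : Type*}

/-! Every component of the state used below only grows, so a fact once established stays true, and a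
fact that holds at some time but not initially was made true by one identifiable step. Inverting
that step tells which rule was applied and what its guard was. Signatures cannot be forged
(`Authentic`), and every quorum contains a correct validator because $\tau(n)>f$ when $3f<n$. Hence
a transaction bearing a quorum can be traced back to a correct user who applied a rule. Conversely
$n-f\ge\tau(n)$, so the correct validators alone form a quorum. Liveness arguments all have one
shape: a guard is shown to hold from some time on, and fairness then forces its effect.

Safety rests on ownership in $\Psi$. A coin never goes to an account that has held it before, so the
owners named in a bulk close determine the recorded prefix of transfers
(`FreshTransfers.prefix_injective`); hence a bulk close lists at most one sequence. No payment is
valid after a bulk close, so all bulk closes written in $\Psi$ name the owners after all transfers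
and therefore coincide. This gives agreement. The same bulk close is the only one that $\Omega$ can
hold, since $\Omega$ demands attestations containing that of a correct validator.

Termination and COMMIT-Validity follow from the dichotomy `commit_or_proposesAbort`, applied to any
bulk close signed by a correct user. If the signer's view already contained all transfers that will
ever be recorded, the bulk close stays correct, signatures accumulate, and it gets written
(`close_written`). Otherwise the first transfer beyond that view spends a coin of an owner named in
the bulk close, and a correct user who has received it can prove the fraud. An abort transaction
stays valid once its payment is recorded, so it is written and all decide ABORT.

For creation, suppose that no childchain ever appeared. Then offered coins are unspent and keep
their owners, one volunteer gathers enough join messages, its transaction remains verifiable,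
signatures accumulate, and it would have to be written. Privacy holds because an outsider stores no
block of $\Psi$, correct users send requests to close only to validators, and the bulk close is the
only source left after the last abort. -/

/-- All components of the state `s` are preserved in `s'`. -/
structure State.Le (s s' : State P Acct Coin) : Prop where
  signed : ∀ p, s.signed p ⊆ s'.signed p
  sent : s.sent ⊆ s'.sent
  rcvd : ∀ p, s.rcvd p ⊆ s'.rcvd p
  joined : ∀ p, s.joined p ⊆ s'.joined p
  parent : ∀ p, s.parent p <+: s'.parent p
  child : ∀ p, s.child p <+: s'.child p
  parentPool : s.parentPool ⊆ s'.parentPool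
  childPool : s.childPool ⊆ s'.childPool
  decided : ∀ p, s.decided p ⊆ s'.decided p

theorem State.Le.refl (s : State P Acct Coin) : s.Le s :=
  ⟨fun _ => subset_rfl, subset_rfl, fun _ => subset_rfl, fun _ => subset_rfl,
    fun _ => List.prefix_rfl, fun _ => List.prefix_rfl, subset_rfl, subset_rfl,
    fun _ => subset_rfl⟩

theorem State.Le.trans {s s' s'' : State P Acct Coin} (h : s.Le s') (h' : s'.Le s'') :
    s.Le s'' :=
  ⟨fun p => (h.signed p).trans (h'.signed p), h.sent.trans h'.sent,
    fun p => (h.rcvd p).trans (h'.rcvd p), fun p => (h.joined p).trans (h'.joined p),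
    fun p => (h.parent p).trans (h'.parent p), fun p => (h.child p).trans (h'.child p),
    h.parentPool.trans h'.parentPool, h.childPool.trans h'.childPool,
    fun p => (h.decided p).trans (h'.decided p)⟩

theorem subset_update_insert {X : Type*} (f : P → Set X) (q : P) (x : X) (p : P) :
    f p ⊆ Function.update f q (insert x (f q)) p := by
  by_cases h : p = q
  · subst h; simp
  · simp [h]

theorem finset_subset_update_insert {X : Type*} (f : P → Finset X) (q : P) (x : X) (p : P) :
    f p ⊆ Function.update f q (insert x (f q)) p := by
  by_cases h : p = q
  · subst h; simp
  · simp [h]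

theorem prefix_update_append {X : Type*} (f : P → List X) (q : P) (x : X) (p : P) :
    f p <+: Function.update f q (f q ++ [x]) p := by
  by_cases h : p = q
  · subst h; simp
  · simp [h]

theorem mem_update_insert {X : Type*} {f : P → Set X} {q p : P} {x y : X} :
    y ∈ Function.update f q (insert x (f q)) p ↔ y ∈ f p ∨ (p = q ∧ y = x) := by
  by_cases h : p = q
  · subst h; simp [or_comm]
  · simp [h]

theorem State.le_sign (s : State P Acct Coin) (p : P) (x : Stmt P Acct Coin) :
    s.Le (s.sign p x) :=
  { State.Le.refl s with signed := fun _ => subset_update_insert _ _ _ _ }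

theorem State.le_multicast (s : State P Acct Coin) (V : Set P) (m : Msg P Acct Coin) :
    s.Le (s.multicast V m) :=
  { State.Le.refl s with sent := Set.subset_union_left }

theorem State.le_toParent (s : State P Acct Coin) (p : P) (x : ParentTx P Acct Coin) :
    s.Le (s.toParent p x) :=
  { State.Le.refl s with parentPool := Set.subset_insert _ _ }

theorem State.le_toChild (s : State P Acct Coin) (p : P) (x : ChildTx P Acct Coin) :
    s.Le (s.toChild p x) :=
  { State.Le.refl s with childPool := Set.subset_insert _ _ }

theorem State.le_decide (s : State P Acct Coin) (p : P) (v : Verdict) (cl : Owners Acct Coin) :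
    s.Le (s.decide p v cl) :=
  { State.Le.refl s with decided := fun _ => subset_update_insert _ _ _ _ }

theorem State.le_addJoin (s : State P Acct Coin) (p : P) (j : Join P Coin) :
    s.Le (s.addJoin p j) :=
  { State.Le.refl s with joined := fun _ => finset_subset_update_insert _ _ _ _ }

theorem le_gather (G : Setup P Acct Coin) (s : State P Acct Coin) (p : P) (j : Join P Coin) :
    s.Le (gather G s p j) := by
  unfold gather
  dsimp only
  split_ifs
  · exact (s.le_addJoin p j).trans ((State.le_sign _ _ _).trans (State.le_multicast _ _ _))
  · exact s.le_addJoin p j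

theorem le_signCreate (G : Setup P Acct Coin) (s : State P Acct Coin) (p : P)
    (ct : CreateTx P Acct Coin) (S : Finset P) : s.Le (signCreate G s p ct S) := by
  unfold signCreate
  dsimp only
  split_ifs
  · exact (s.le_sign p _).trans (State.le_multicast _ _ _)
  · exact (s.le_sign p _).trans (State.le_toParent _ _ _)

theorem le_startClose (s : State P Acct Coin) (p : P) (ct : CreateTx P Acct Coin) :
    s.Le (startClose s p ct) :=
  let h := (s.le_sign p (Stmt.close (currentOwners s p ct))).trans (State.le_multicast _
    (ct.validators : Set P) (Msg.closeReq (currentOwners s p ct) {p}))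
  ⟨h.signed, h.sent, h.rcvd, h.joined, h.parent, h.child, h.parentPool, h.childPool, h.decided⟩

theorem le_signClose (s : State P Acct Coin) (p : P) (ct : CreateTx P Acct Coin)
    (cl : Owners Acct Coin) (S : Finset P) : s.Le (signClose s p ct cl S) := by
  unfold signClose
  dsimp only
  split_ifs
  · exact (s.le_sign p _).trans (State.le_toChild _ _ _)
  · exact (s.le_sign p _).trans (State.le_multicast _ _ _)

theorem Step.le {G : Setup P Acct Coin} {s s' : State P Acct Coin} (h : Step G s s') :
    s.Le s' := by
  cases h with
  | idle => exact State.Le.refl s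
  | join p j _ _ => exact (s.le_sign p _).trans (State.le_multicast _ _ _)
  | gather p j _ _ => exact le_gather G s p j
  | signCreate p ct S _ _ => exact le_signCreate G s p ct S
  | payParent p tr _ _ _ => exact (s.le_sign p _).trans (State.le_toParent _ _ _)
  | payChild p ct tr _ _ _ _ => exact (s.le_sign p _).trans (State.le_toChild _ _ _)
  | startClose p ct _ _ => exact le_startClose s p ct
  | signClose p ct cl S _ _ => exact le_signClose s p ct cl S
  | abort p ct cl S ab _ _ => exact (s.le_toParent p _).trans (State.le_toChild _ _ _)
  | decideCommit p ct cl S T _ _ => exact (s.le_decide p _ _).trans (State.le_toParent _ _ _)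
  | decideAbort p ct ab _ _ => exact (s.le_decide p _ _).trans (State.le_toParent _ _ _)
  | parentBlock p b _ =>
      exact { State.Le.refl s with parent := fun _ => prefix_update_append _ _ _ _ }
  | childBlock p ct b _ _ =>
      exact { State.Le.refl s with child := fun _ => prefix_update_append _ _ _ _ }
  | deliver q m _ =>
      exact { State.Le.refl s with rcvd := fun _ => subset_update_insert _ _ _ _ }
  | byzMsg z q m _ _ =>
      exact { State.Le.refl s with rcvd := fun _ => subset_update_insert _ _ _ _ }
  | byzParent z x _ _ => exact s.le_toParent z x
  | byzChild z x _ _ => exact s.le_toChild z x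

/-! ### Inversion of steps: which rule can produce a given change. -/

variable {G : Setup P Acct Coin} {s s' : State P Acct Coin}

/-- Only the rule `join` signs such a statement, and its guard requires that no join message was
signed before; this yields the uniqueness in the last conjunct. -/
theorem Step.signed_join (h : Step G s s') {p : P} {j : Join P Coin}
    (hn : Stmt.join j ∉ s.signed p) (hj : Stmt.join j ∈ s'.signed p) :
    p ∉ G.byz ∧ JoinEnabled G s p j ∧ (∀ q, (q, Msg.join j) ∈ s'.sent) ∧
      ∀ j', Stmt.join j' ∈ s'.signed p → j' = j := by
  cases h with
  | gather q i _ _ =>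
    unfold Platypus.gather at hj
    dsimp only at hj
    split_ifs at hj <;>
      simp_all [State.sign, State.multicast, State.addJoin, mem_update_insert]
  | signCreate q ct S _ _ =>
    unfold Platypus.signCreate at hj
    dsimp only at hj
    split_ifs at hj <;>
      simp_all [State.sign, State.multicast, State.toParent, mem_update_insert]
  | signClose q ct cl S _ _ =>
    unfold Platypus.signClose at hj
    dsimp only at hj
    split_ifs at hj <;>
      simp_all [State.sign, State.multicast, State.toChild, mem_update_insert]
  | join q i hq hi =>
    have hpc : p = q ∧ j = i := by
      simp_all [State.sign, State.multicast, mem_update_insert]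
    obtain ⟨rfl, rfl⟩ := hpc
    refine ⟨hq, hi, by simp [State.multicast], fun j' hj' => ?_⟩
    have := hi.2.1 j'
    simp_all [State.sign, State.multicast]
  | _ => simp_all [State.sign, State.multicast, State.toParent, State.toChild, State.decide,
      Platypus.startClose, mem_update_insert]

/-- Both rules that sign a creation transaction check the number of validators: the branching
condition of `gather` and `VerifyCreate` in `signCreate`. -/
theorem Step.signed_create (h : Step G s s') {p : P} {ct : CreateTx P Acct Coin}
    (hn : Stmt.create ct ∉ s.signed p) (hj : Stmt.create ct ∈ s'.signed p) :
    ct.validators.card = G.mv := by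
  cases h with
  | gather q i _ _ =>
    unfold Platypus.gather at hj
    dsimp only at hj
    split_ifs at hj <;>
      simp_all [State.sign, State.multicast, State.addJoin, mem_update_insert]
  | signCreate q ct S _ h =>
    have := h.2.2.2.1
    unfold Platypus.signCreate at hj
    dsimp only at hj
    split_ifs at hj <;>
      simp_all [State.sign, State.multicast, State.toParent, mem_update_insert]
  | signClose q ct cl S _ _ =>
    unfold Platypus.signClose at hj
    dsimp only at hj
    split_ifs at hj <;>
      simp_all [State.sign, State.multicast, State.toChild, mem_update_insert]
  | _ => simp_all [State.sign, State.multicast, State.toParent, State.toChild, State.decide,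
      Platypus.startClose, mem_update_insert]

/-- The final disjunction guarantees that some correct user can later act on the bulk close. Either
the request goes out to all validators, or the signer completed a quorum; in that case it had itself
received a request, which is what the abort rule demands. -/
theorem Step.signed_close (h : Step G s s') {p : P} {cl : Owners Acct Coin}
    (hn : Stmt.close cl ∉ s.signed p) (hj : Stmt.close cl ∈ s'.signed p) :
    p ∉ G.byz ∧ ∃ ct, InChild s p ct ∧ cl = currentOwners s p ct ∧
      ((∃ S, ∀ v ∈ ct.validators, (v, Msg.closeReq cl S) ∈ s'.sent) ∨
        ∃ S S', Msg.closeReq cl S ∈ s.rcvd p ∧ Quorum ct S' ∧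
          (p, ChildTx.close cl S') ∈ s'.childPool) := by
  cases h with
  | gather q i _ _ =>
    unfold Platypus.gather at hj
    dsimp only at hj
    split_ifs at hj <;>
      simp_all [State.sign, State.multicast, State.addJoin, mem_update_insert]
  | signCreate q ct S _ h =>
    unfold Platypus.signCreate at hj
    dsimp only at hj
    split_ifs at hj <;>
      simp_all [State.sign, State.multicast, State.toParent, mem_update_insert]
  | signClose q ct cl' S hq h =>
    have hpc : p = q ∧ cl = cl' := by
      unfold Platypus.signClose at hj
      dsimp only at hj
      split_ifs at hj <;>
        simp_all [State.sign, State.multicast, State.toChild, mem_update_insert]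
    obtain ⟨rfl, rfl⟩ := hpc
    refine ⟨hq, ct, h.1, h.2.2.2.2, ?_⟩
    unfold Platypus.signClose
    dsimp only
    split_ifs with hQ
    · exact Or.inr ⟨S, _, h.2.2.1, hQ, by simp [State.toChild]⟩
    · exact Or.inl ⟨insert p S, fun v hv => by simp [State.multicast, hv]⟩
  | startClose q ct hq h =>
    have hpc : p = q ∧ cl = currentOwners s q ct := by
      simp_all [State.sign, State.multicast, Platypus.startClose, mem_update_insert]
    obtain ⟨rfl, rfl⟩ := hpc
    exact ⟨hq, ct, h, rfl, Or.inl ⟨{p}, fun v hv => by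
      simp [State.multicast, Platypus.startClose, hv]⟩⟩
  | _ => simp_all [State.sign, State.multicast, State.toParent, State.toChild, State.decide,
      mem_update_insert]

/-- This serves privacy: requests to close are addressed by correct users to validators only, hence
never to an outsider. -/
theorem Step.sent_closeReq (h : Step G s s') {q : P} {cl : Owners Acct Coin} {S : Finset P}
    (hn : (q, Msg.closeReq cl S) ∉ s.sent) (hj : (q, Msg.closeReq cl S) ∈ s'.sent) :
    ∃ p ∉ G.byz, ∃ ct, InChild s p ct ∧ q ∈ ct.validators := by
  cases h with
  | gather q i _ _ =>
    unfold Platypus.gather at hj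
    dsimp only at hj
    split_ifs at hj <;>
      simp_all [State.sign, State.multicast, State.addJoin]
  | signCreate q ct S _ h =>
    unfold Platypus.signCreate at hj
    dsimp only at hj
    split_ifs at hj <;>
      simp_all [State.sign, State.multicast, State.toParent]
  | signClose p ct cl' S hp h =>
    refine ⟨p, hp, ct, h.1, ?_⟩
    unfold Platypus.signClose at hj
    dsimp only at hj
    split_ifs at hj <;>
      simp_all [State.sign, State.multicast, State.toChild]
  | startClose p ct hp h =>
    refine ⟨p, hp, ct, h, ?_⟩
    simp_all [State.sign, State.multicast, Platypus.startClose]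
  | _ => simp_all [State.sign, State.multicast, State.toParent, State.toChild, State.decide]

theorem Step.joined (h : Step G s s') {p : P} (hn : s'.joined p ≠ s.joined p) :
    p ∉ G.byz ∧ ∃ j, GatherEnabled G s p j ∧ s' = Platypus.gather G s p j := by
  cases h with
  | gather q i hq h =>
    have hpq : p = q := by
      by_contra hpq
      apply hn
      unfold Platypus.gather
      dsimp only
      split_ifs <;>
        simp [State.sign, State.multicast, State.addJoin, hpq]
    subst hpq
    exact ⟨hq, i, h, rfl⟩
  | signCreate q ct S _ h =>
    unfold Platypus.signCreate at hn
    dsimp only at hn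
    split_ifs at hn <;>
      simp_all [State.sign, State.multicast, State.toParent]
  | signClose p ct cl' S hp h =>
    unfold Platypus.signClose at hn
    dsimp only at hn
    split_ifs at hn <;>
      simp_all [State.sign, State.multicast, State.toChild]
  | _ => simp_all [State.sign, State.multicast, State.toParent, State.toChild, State.decide,
      Platypus.startClose]

theorem Step.child (h : Step G s s') {p : P} (hn : s'.child p ≠ s.child p) :
    ∃ ct, InChild s p ct ∧ p ∉ G.byz := by
  cases h with
  | gather q i hq h =>
    unfold Platypus.gather at hn
    dsimp only at hn
    split_ifs at hn <;>
      simp_all [State.sign, State.multicast, State.addJoin]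
  | signCreate q ct S _ h =>
    unfold Platypus.signCreate at hn
    dsimp only at hn
    split_ifs at hn <;>
      simp_all [State.sign, State.multicast, State.toParent]
  | signClose p ct cl' S hp h =>
    unfold Platypus.signClose at hn
    dsimp only at hn
    split_ifs at hn <;>
      simp_all [State.sign, State.multicast, State.toChild]
  | childBlock q ct b hq h =>
    have hpq : p = q := by
      by_contra hpq
      exact hn (by simp [hpq])
    subst hpq
    exact ⟨ct, h, hq⟩
  | _ => simp_all [State.sign, State.multicast, State.toParent, State.toChild, State.decide,
      Platypus.startClose]

theorem Step.decided_commit (h : Step G s s') {p : P} {cl : Owners Acct Coin}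
    (hn : (Verdict.commit, cl) ∉ s.decided p) (hj : (Verdict.commit, cl) ∈ s'.decided p) :
    p ∉ G.byz ∧ ∃ ct S T, CommitEnabled G s p ct cl S T ∧
      (p, ParentTx.close cl S T) ∈ s'.parentPool := by
  cases h with
  | gather q i hq h =>
    unfold Platypus.gather at hj
    dsimp only at hj
    split_ifs at hj <;>
      simp_all [State.sign, State.multicast, State.addJoin]
  | signCreate q ct S _ h =>
    unfold Platypus.signCreate at hj
    dsimp only at hj
    split_ifs at hj <;>
      simp_all [State.sign, State.multicast, State.toParent]
  | signClose p ct cl' S hp h =>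
    unfold Platypus.signClose at hj
    dsimp only at hj
    split_ifs at hj <;>
      simp_all [State.sign, State.multicast, State.toChild]
  | decideCommit q ct cl' S T hq h =>
    have hpc : p = q ∧ cl = cl' := by
      simp_all [State.decide, State.toParent, mem_update_insert]
    obtain ⟨rfl, rfl⟩ := hpc
    exact ⟨hq, ct, S, T, h, by simp [State.toParent]⟩
  | _ => simp_all [State.sign, State.multicast, State.toParent, State.toChild, State.decide,
      Platypus.startClose, mem_update_insert]

/-- Correctness of `p` rules out `byzChild`, which would otherwise put an arbitrary authentic
transaction under the name of `p`. -/
theorem Step.childPool_abort (h : Step G s s') {p : P} (hp : p ∉ G.byz)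
    {ab : AbortTx P Acct Coin}
    (hn : (p, ChildTx.abort ab) ∉ s.childPool) (hj : (p, ChildTx.abort ab) ∈ s'.childPool) :
    ∃ ct cl S, AbortEnabled G s p ct cl S ab := by
  cases h with
  | gather q i hq h =>
    unfold Platypus.gather at hj
    dsimp only at hj
    split_ifs at hj <;>
      simp_all [State.sign, State.multicast, State.addJoin]
  | signCreate q ct S _ h =>
    unfold Platypus.signCreate at hj
    dsimp only at hj
    split_ifs at hj <;>
      simp_all [State.sign, State.multicast, State.toParent]
  | signClose p ct cl' S hp h =>
    unfold Platypus.signClose at hj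
    dsimp only at hj
    split_ifs at hj <;>
      simp_all [State.sign, State.multicast, State.toChild]
  | abort q ct cl S ab' hq h =>
    have hpc : p = q ∧ ab = ab' := by
      simp_all [State.toChild, State.toParent]
    obtain ⟨rfl, rfl⟩ := hpc
    exact ⟨ct, cl, S, h⟩
  | byzChild z x hz _ =>
    have hpc : p = z := by
      simp_all [State.toChild]
    exact absurd (hpc ▸ hz) hp
  | _ => simp_all [State.sign, State.multicast, State.toParent, State.toChild, State.decide,
      Platypus.startClose]

theorem Step.started (h : Step G s s') {p : P} {cl : Owners Acct Coin}
    (hn : (p, cl) ∉ s.started) (hj : (p, cl) ∈ s'.started) :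
    Stmt.close cl ∈ s'.signed p := by
  cases h with
  | gather q i hq h =>
    unfold Platypus.gather at hj
    dsimp only at hj
    split_ifs at hj <;>
      simp_all [State.sign, State.multicast, State.addJoin]
  | signCreate q ct S _ h =>
    unfold Platypus.signCreate at hj
    dsimp only at hj
    split_ifs at hj <;>
      simp_all [State.sign, State.multicast, State.toParent]
  | signClose p ct cl' S hp h =>
    unfold Platypus.signClose at hj
    dsimp only at hj
    split_ifs at hj <;>
      simp_all [State.sign, State.multicast, State.toChild]
  | startClose q ct hq h =>
    have hpc : p = q ∧ cl = currentOwners s q ct := by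
      simp_all [State.sign, State.multicast, Platypus.startClose]
    obtain ⟨rfl, rfl⟩ := hpc
    simp [State.sign, State.multicast, Platypus.startClose]
  | _ => simp_all [State.sign, State.multicast, State.toParent, State.toChild, State.decide]

end Platypus

/-! ### Authenticity of the signatures in circulation. -/

namespace Platypus

variable {P Acct Coin : Type*} {G : Setup P Acct Coin} {s s' : State P Acct Coin}

theorem SignedBy.mono (h : s.Le s') {x : Stmt P Acct Coin} {S : Finset P}
    (hx : SignedBy G s x S) : SignedBy G s' x S :=
  fun q hq hb => h.signed q (hx q hq hb)

theorem AuthCreate.mono (h : s.Le s') {ct : CreateTx P Acct Coin} {S : Finset P}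
    (hx : AuthCreate G s ct S) : AuthCreate G s' ct S :=
  ⟨fun j hj => SignedBy.mono h (hx.1 j hj), SignedBy.mono h hx.2⟩

theorem AuthMsg.mono (h : s.Le s') : ∀ {m : Msg P Acct Coin}, AuthMsg G s m → AuthMsg G s' m
  | Msg.join _, hx => SignedBy.mono h hx
  | Msg.createReq _ _, hx => AuthCreate.mono h hx
  | Msg.closeReq _ _, hx => SignedBy.mono h hx

theorem State.Le.childLog (h : s.Le s') (p : P) : s.childLog p <+: s'.childLog p :=
  (h.child p).flatten

theorem State.Le.parentLog (h : s.Le s') (p : P) : s.parentLog p <+: s'.parentLog p :=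
  (h.parent p).flatten

theorem Attested.mono (h : s.Le s') {x : ChildTx P Acct Coin} {S : Finset P}
    (hx : Attested G s x S) : Attested G s' x S :=
  fun q hq hb => (h.childLog q).subset (hx q hq hb)

/-- The signatures in circulation exist. -/
structure Authentic (G : Setup P Acct Coin) (s : State P Acct Coin) : Prop where
  sent : ∀ q m, (q, m) ∈ s.sent → AuthMsg G s m
  rcvd : ∀ q, ∀ m ∈ s.rcvd q, AuthMsg G s m
  joined : ∀ q, ∀ j ∈ s.joined q, AuthJoin G s j
  create : ∀ r ct S, (r, ParentTx.create ct S) ∈ s.parentPool → AuthCreate G s ct S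
  attested : ∀ r cl S T, (r, ParentTx.close cl S T) ∈ s.parentPool →
    Attested G s (ChildTx.close cl S) T
  close : ∀ r cl S, (r, ChildTx.close cl S) ∈ s.childPool → SignedBy G s (Stmt.close cl) S

theorem Authentic.start : Authentic G (State.start : State P Acct Coin) := by
  constructor <;> simp [State.start]

theorem SignedBy.insert_self {x : Stmt P Acct Coin} {S : Finset P} {p : P}
    (h : SignedBy G s x S) (hp : x ∈ s.signed p) : SignedBy G s x (insert p S) := by
  intro q hq hb
  rcases Finset.mem_insert.1 hq with rfl | hq
  · exact hp
  · exact h q hq hb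

theorem SignedBy.singleton {x : Stmt P Acct Coin} {p : P} (hp : x ∈ s.signed p) :
    SignedBy G s x {p} := by
  intro q hq _
  rw [Finset.mem_singleton.1 hq]
  exact hp

theorem State.mem_sign (s : State P Acct Coin) (p : P) (x : Stmt P Acct Coin) :
    x ∈ (s.sign p x).signed p := by simp [State.sign]

/-- Signatures persist, so old entries stay authentic and each rule has to account only for the
entries that it adds. -/
theorem Authentic.of_le (h : s.Le s') (ha : Authentic G s)
    (sent : ∀ q m, (q, m) ∈ s'.sent → (q, m) ∈ s.sent ∨ AuthMsg G s' m)
    (rcvd : ∀ q, ∀ m ∈ s'.rcvd q, m ∈ s.rcvd q ∨ AuthMsg G s' m)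
    (joined : ∀ q, ∀ j ∈ s'.joined q, j ∈ s.joined q ∨ AuthJoin G s' j)
    (create : ∀ r ct S, (r, ParentTx.create ct S) ∈ s'.parentPool →
      (r, ParentTx.create ct S) ∈ s.parentPool ∨ AuthCreate G s' ct S)
    (attested : ∀ r cl S T, (r, ParentTx.close cl S T) ∈ s'.parentPool →
      (r, ParentTx.close cl S T) ∈ s.parentPool ∨ Attested G s' (ChildTx.close cl S) T)
    (close : ∀ r cl S, (r, ChildTx.close cl S) ∈ s'.childPool →
      (r, ChildTx.close cl S) ∈ s.childPool ∨ SignedBy G s' (Stmt.close cl) S) :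
    Authentic G s' where
  sent q m hm := (sent q m hm).elim (fun hm => (ha.sent q m hm).mono h) id
  rcvd q m hm := (rcvd q m hm).elim (fun hm => (ha.rcvd q m hm).mono h) id
  joined q j hj := (joined q j hj).elim (fun hj => SignedBy.mono h (ha.joined q j hj)) id
  create r ct S hx := (create r ct S hx).elim (fun hx => (ha.create r ct S hx).mono h) id
  attested r cl S T hx :=
    (attested r cl S T hx).elim (fun hx => (ha.attested r cl S T hx).mono h) id
  close r cl S hx := (close r cl S hx).elim (fun hx => (ha.close r cl S hx).mono h) id

theorem Authentic.sign (h : Authentic G s) (p : P) (x : Stmt P Acct Coin) :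
    Authentic G (s.sign p x) :=
  h.of_le (s.le_sign p x) (fun _ _ => Or.inl) (fun _ _ => Or.inl) (fun _ _ => Or.inl)
    (fun _ _ _ => Or.inl) (fun _ _ _ _ => Or.inl) (fun _ _ _ => Or.inl)

theorem Authentic.multicast (h : Authentic G s) (V : Set P) {m : Msg P Acct Coin}
    (hm : AuthMsg G s m) : Authentic G (s.multicast V m) :=
  h.of_le (s.le_multicast V m)
    (fun _ _ hx => by
      rcases hx with hx | ⟨-, rfl⟩
      · exact Or.inl hx
      · exact Or.inr (hm.mono (s.le_multicast V _)))
    (fun _ _ => Or.inl) (fun _ _ => Or.inl)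
    (fun _ _ _ => Or.inl) (fun _ _ _ _ => Or.inl) (fun _ _ _ => Or.inl)

theorem Authentic.addJoin (h : Authentic G s) (p : P) {j : Join P Coin} (hj : AuthJoin G s j) :
    Authentic G (s.addJoin p j) :=
  h.of_le (s.le_addJoin p j) (fun _ _ => Or.inl) (fun _ _ => Or.inl)
    (fun q i hi => by
      by_cases hq : q = p
      · subst hq
        simp only [State.addJoin, Function.update_self, Finset.mem_insert] at hi
        rcases hi with rfl | hi
        · exact Or.inr (SignedBy.mono (s.le_addJoin q i) hj)
        · exact Or.inl hi
      · exact Or.inl (by simpa [State.addJoin, hq] using hi))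
    (fun _ _ _ => Or.inl) (fun _ _ _ _ => Or.inl) (fun _ _ _ => Or.inl)

theorem Authentic.toParent (h : Authentic G s) (p : P) {x : ParentTx P Acct Coin}
    (hc : ∀ ct S, x = ParentTx.create ct S → AuthCreate G s ct S)
    (ha : ∀ cl S T, x = ParentTx.close cl S T → Attested G s (ChildTx.close cl S) T) :
    Authentic G (s.toParent p x) :=
  h.of_le (s.le_toParent p x) (fun _ _ => Or.inl) (fun _ _ => Or.inl) (fun _ _ => Or.inl)
    (fun _ _ _ hx => (Set.mem_insert_iff.1 hx).symm.imp id fun hx =>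
      (hc _ _ (Prod.ext_iff.1 hx).2.symm).mono (s.le_toParent p x))
    (fun _ _ _ _ hx => (Set.mem_insert_iff.1 hx).symm.imp id fun hx =>
      (ha _ _ _ (Prod.ext_iff.1 hx).2.symm).mono (s.le_toParent p x))
    (fun _ _ _ => Or.inl)

theorem Authentic.toChild (h : Authentic G s) (p : P) {x : ChildTx P Acct Coin}
    (hc : ∀ cl S, x = ChildTx.close cl S → SignedBy G s (Stmt.close cl) S) :
    Authentic G (s.toChild p x) :=
  h.of_le (s.le_toChild p x) (fun _ _ => Or.inl) (fun _ _ => Or.inl) (fun _ _ => Or.inl)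
    (fun _ _ _ => Or.inl) (fun _ _ _ _ => Or.inl)
    (fun _ _ _ hx => (Set.mem_insert_iff.1 hx).symm.imp id fun hx =>
      (hc _ _ (Prod.ext_iff.1 hx).2.symm).mono (s.le_toChild p x))

theorem Authentic.receive (h : Authentic G s) (q : P) {m : Msg P Acct Coin}
    (hm : AuthMsg G s m) :
    Authentic G { s with rcvd := Function.update s.rcvd q (insert m (s.rcvd q)) } :=
  let hle : s.Le { s with rcvd := Function.update s.rcvd q (insert m (s.rcvd q)) } :=
    { State.Le.refl s with rcvd := fun _ => subset_update_insert _ _ _ _ }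
  h.of_le hle (fun _ _ => Or.inl)
    (fun _ _ hx => by
      rcases mem_update_insert.1 hx with hx | ⟨-, rfl⟩
      · exact Or.inl hx
      · exact Or.inr (hm.mono hle))
    (fun _ _ => Or.inl)
    (fun _ _ _ => Or.inl) (fun _ _ _ _ => Or.inl) (fun _ _ _ => Or.inl)

theorem Step.authentic (h : Step G s s') (ha : Authentic G s) : Authentic G s' := by
  cases h with
  | idle => exact ha
  | join p j _ h =>
    refine (ha.sign p _).multicast _ (m := Msg.join j) ?_
    change SignedBy G _ _ {j.sender}
    rw [h.1]
    exact SignedBy.singleton (s.mem_sign p _)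
  | gather p j _ h =>
    have h1 := ha.addJoin p (ha.rcvd p _ h.2.1)
    unfold Platypus.gather
    dsimp only
    split_ifs
    · refine (h1.sign p _).multicast _
        (m := Msg.createReq (mkCreate G (s.addJoin p j) p) {p}) ⟨fun i hi => ?_, ?_⟩
      · exact SignedBy.mono (State.le_sign _ _ _) (h1.joined p i hi)
      · exact SignedBy.singleton (State.mem_sign _ p _)
    · exact h1
  | signCreate p ct S _ h =>
    have h1 := ha.sign p (Stmt.create ct)
    have h2 : AuthCreate G (s.sign p (Stmt.create ct)) ct (insert p S) := by
      have h3 : AuthCreate G s ct S := ha.rcvd p _ h.2.1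
      have h4 := h3.mono (s.le_sign p (Stmt.create ct))
      exact ⟨h4.1, h4.2.insert_self (s.mem_sign p _)⟩
    unfold Platypus.signCreate
    dsimp only
    split_ifs
    · exact h1.multicast _ (m := Msg.createReq ct (insert p S)) h2
    · refine h1.toParent p ?_ ?_
      · rintro ct' S' h
        cases h
        exact h2
      · rintro cl S T ⟨⟩
  | payParent p tr _ _ _ =>
    refine (ha.sign p _).toParent p ?_ ?_
    · rintro ct' S' ⟨⟩
    · rintro cl S T ⟨⟩
  | payChild p ct tr _ _ _ _ =>
    refine (ha.sign p _).toChild p ?_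
    rintro cl S ⟨⟩
  | startClose p ct _ _ =>
    have h1 := (ha.sign p (Stmt.close (currentOwners s p ct))).multicast (ct.validators : Set P)
      (m := Msg.closeReq (currentOwners s p ct) {p}) (SignedBy.singleton (s.mem_sign p _))
    exact ⟨h1.sent, h1.rcvd, h1.joined, h1.create, h1.attested, h1.close⟩
  | signClose p ct cl S _ h =>
    have h1 := ha.sign p (Stmt.close cl)
    have h2 : SignedBy G (s.sign p (Stmt.close cl)) (Stmt.close cl) (insert p S) := by
      have h3 : SignedBy G s (Stmt.close cl) S := ha.rcvd p _ h.2.2.1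
      exact (h3.mono (s.le_sign p _)).insert_self (s.mem_sign p _)
    unfold Platypus.signClose
    dsimp only
    split_ifs
    · refine h1.toChild p ?_
      rintro cl S h
      cases h
      exact h2
    · exact h1.multicast _ (m := Msg.closeReq cl (insert p S)) h2
  | abort p ct cl S ab _ _ =>
    refine (ha.toParent p ?_ ?_).toChild p ?_
    · rintro ct' S' ⟨⟩
    · rintro cl S T ⟨⟩
    · rintro cl S ⟨⟩
  | decideCommit p ct cl S T _ h =>
    have h1 : Authentic G (s.decide p Verdict.commit cl) :=
      ha.of_le (s.le_decide p _ _) (fun _ _ => Or.inl) (fun _ _ => Or.inl) (fun _ _ => Or.inl)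
        (fun _ _ _ => Or.inl) (fun _ _ _ _ => Or.inl) (fun _ _ _ => Or.inl)
    refine h1.toParent p ?_ ?_
    · rintro ct' S' ⟨⟩
    · rintro cl S T h'
      cases h'
      exact h.2.2.2.mono (s.le_decide p _ _)
  | decideAbort p ct ab _ _ =>
    have h1 : Authentic G (s.decide p Verdict.abort ab.claims) :=
      ha.of_le (s.le_decide p _ _) (fun _ _ => Or.inl) (fun _ _ => Or.inl) (fun _ _ => Or.inl)
        (fun _ _ _ => Or.inl) (fun _ _ _ _ => Or.inl) (fun _ _ _ => Or.inl)
    refine h1.toParent p ?_ ?_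
    · rintro ct' S' ⟨⟩
    · rintro cl S T ⟨⟩
  | parentBlock p b _ =>
    exact ha.of_le { State.Le.refl s with parent := fun _ => prefix_update_append _ _ _ _ }
      (fun _ _ => Or.inl) (fun _ _ => Or.inl) (fun _ _ => Or.inl)
      (fun _ _ _ => Or.inl) (fun _ _ _ _ => Or.inl) (fun _ _ _ => Or.inl)
  | childBlock p ct b _ _ =>
    exact ha.of_le { State.Le.refl s with child := fun _ => prefix_update_append _ _ _ _ }
      (fun _ _ => Or.inl) (fun _ _ => Or.inl) (fun _ _ => Or.inl)
      (fun _ _ _ => Or.inl) (fun _ _ _ _ => Or.inl) (fun _ _ _ => Or.inl)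
  | deliver q m h => exact ha.receive q (ha.sent q m h)
  | byzMsg z q m _ h => exact ha.receive q h
  | byzParent z x _ h =>
    refine ha.toParent z ?_ ?_
    · rintro ct' S' rfl
      exact h
    · rintro cl S T rfl
      exact h.2
  | byzChild z x _ h =>
    refine ha.toChild z ?_
    rintro cl S rfl
    exact h

/-! ### Executions -/

variable {E : ℕ → State P Acct Coin}

theorem Execution.le (hE : Execution G E) {t t' : ℕ} (h : t ≤ t') : (E t).Le (E t') := by
  induction h with
  | refl => exact State.Le.refl _
  | step _ ih => exact ih.trans (hE.step _).le

theorem Execution.authentic (hE : Execution G E) (t : ℕ) : Authentic G (E t) := by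
  induction t with
  | zero => rw [hE.start]; exact Authentic.start
  | succ t ih => exact (hE.step t).authentic ih

/-- What holds at some time but not at the beginning becomes true at some step. -/
theorem exists_step_of_not_zero {Q : ℕ → Prop} (h0 : ¬ Q 0) {t : ℕ} (ht : Q t) :
    ∃ i < t, ¬ Q i ∧ Q (i + 1) := by
  induction t with
  | zero => exact absurd ht h0
  | succ t ih =>
    by_cases h : Q t
    · obtain ⟨i, hi, h⟩ := ih h
      exact ⟨i, by omega, h⟩
    · exact ⟨t, by omega, h, ht⟩

theorem Execution.signed_join (hE : Execution G E) {t : ℕ} {p : P} {j : Join P Coin}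
    (h : Stmt.join j ∈ (E t).signed p) :
    ∃ i < t, p ∉ G.byz ∧ JoinEnabled G (E i) p j ∧ ∀ q, (q, Msg.join j) ∈ (E (i + 1)).sent := by
  obtain ⟨i, hi, h0, h1⟩ := exists_step_of_not_zero
    (Q := fun t => Stmt.join j ∈ (E t).signed p) (by simp [hE.start, State.start]) h
  have h2 := (hE.step i).signed_join h0 h1
  exact ⟨i, hi, h2.1, h2.2.1, h2.2.2.1⟩

/-- A correct user signs at most one join message. -/
theorem Execution.join_unique (hE : Execution G E) {t t' : ℕ} {p : P} {j j' : Join P Coin}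
    (h : Stmt.join j ∈ (E t).signed p) (h' : Stmt.join j' ∈ (E t').signed p) : j = j' := by
  obtain ⟨i, -, h0, h1⟩ := exists_step_of_not_zero
    (Q := fun t => Stmt.join j ∈ (E t).signed p) (by simp [hE.start, State.start]) h
  obtain ⟨i', -, h0', h1'⟩ := exists_step_of_not_zero
    (Q := fun t => Stmt.join j' ∈ (E t).signed p) (by simp [hE.start, State.start]) h'
  have e := ((hE.step i).signed_join h0 h1).2.1.2.1
  have e' := ((hE.step i').signed_join h0' h1').2.1.2.1
  -- The later of two signing steps would violate its guard that nothing was signed before; if the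
  -- steps coincide, uniqueness within one step applies.
  rcases lt_trichotomy i i' with hlt | rfl | hlt
  · exact absurd ((hE.le (show i + 1 ≤ i' by omega)).signed p h1) (e' j)
  · exact ((hE.step i).signed_join h0' h1').2.2.2 j h1
  · exact absurd ((hE.le (show i' + 1 ≤ i by omega)).signed p h1') (e j')

theorem Execution.signed_create (hE : Execution G E) {t : ℕ} {p : P} {ct : CreateTx P Acct Coin}
    (h : Stmt.create ct ∈ (E t).signed p) : ct.validators.card = G.mv := by
  obtain ⟨i, -, h0, h1⟩ := exists_step_of_not_zero
    (Q := fun t => Stmt.create ct ∈ (E t).signed p) (by simp [hE.start, State.start]) h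
  exact (hE.step i).signed_create h0 h1

theorem Execution.signed_close (hE : Execution G E) {t : ℕ} {p : P} {cl : Owners Acct Coin}
    (h : Stmt.close cl ∈ (E t).signed p) :
    ∃ i, p ∉ G.byz ∧ ∃ ct, InChild (E i) p ct ∧ cl = currentOwners (E i) p ct ∧
      ((∃ S, ∀ v ∈ ct.validators, (v, Msg.closeReq cl S) ∈ (E (i + 1)).sent) ∨
        ∃ S S', Msg.closeReq cl S ∈ (E i).rcvd p ∧ Quorum ct S' ∧
          (p, ChildTx.close cl S') ∈ (E (i + 1)).childPool) := by
  obtain ⟨i, -, h0, h1⟩ := exists_step_of_not_zero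
    (Q := fun t => Stmt.close cl ∈ (E t).signed p) (by simp [hE.start, State.start]) h
  exact ⟨i, (hE.step i).signed_close h0 h1⟩

theorem Execution.sent_closeReq (hE : Execution G E) {t : ℕ} {q : P} {cl : Owners Acct Coin}
    {S : Finset P} (h : (q, Msg.closeReq cl S) ∈ (E t).sent) :
    ∃ i, ∃ p ∉ G.byz, ∃ ct, InChild (E i) p ct ∧ q ∈ ct.validators := by
  obtain ⟨i, -, h0, h1⟩ := exists_step_of_not_zero
    (Q := fun t => (q, Msg.closeReq cl S) ∈ (E t).sent) (by simp [hE.start, State.start]) h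
  exact ⟨i, (hE.step i).sent_closeReq h0 h1⟩

/-- Blocks of the childchain are appended only by `childBlock`, whose guard is `InChild`. -/
theorem Execution.child_eq_nil (hE : Execution G E) {p : P}
    (h : ∀ t ct, ¬ InChild (E t) p ct) (t : ℕ) : (E t).child p = [] := by
  induction t with
  | zero => simp [hE.start, State.start]
  | succ t ih =>
    by_contra hn
    obtain ⟨ct, hc, -⟩ := (hE.step t).child (p := p) (by rw [ih]; exact hn)
    exact h t ct hc

theorem Execution.decided_commit (hE : Execution G E) {t : ℕ} {p : P} {cl : Owners Acct Coin}
    (h : (Verdict.commit, cl) ∈ (E t).decided p) :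
    ∃ i, p ∉ G.byz ∧ ∃ ct S T, CommitEnabled G (E i) p ct cl S T ∧
      (p, ParentTx.close cl S T) ∈ (E (i + 1)).parentPool := by
  obtain ⟨i, -, h0, h1⟩ := exists_step_of_not_zero
    (Q := fun t => (Verdict.commit, cl) ∈ (E t).decided p) (by simp [hE.start, State.start]) h
  exact ⟨i, (hE.step i).decided_commit h0 h1⟩

theorem Execution.childPool_abort (hE : Execution G E) {t : ℕ} {p : P} (hp : p ∉ G.byz)
    {ab : AbortTx P Acct Coin} (h : (p, ChildTx.abort ab) ∈ (E t).childPool) :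
    ∃ i, ∃ ct cl S, AbortEnabled G (E i) p ct cl S ab := by
  obtain ⟨i, -, h0, h1⟩ := exists_step_of_not_zero
    (Q := fun t => (p, ChildTx.abort ab) ∈ (E t).childPool) (by simp [hE.start, State.start]) h
  exact ⟨i, (hE.step i).childPool_abort hp h0 h1⟩

theorem Execution.started (hE : Execution G E) {t : ℕ} {p : P} {cl : Owners Acct Coin}
    (h : (p, cl) ∈ (E t).started) : ∃ i, Stmt.close cl ∈ (E i).signed p := by
  obtain ⟨i, -, h0, h1⟩ := exists_step_of_not_zero
    (Q := fun t => (p, cl) ∈ (E t).started) (by simp [hE.start, State.start]) h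
  exact ⟨i + 1, (hE.step i).started h0 h1⟩

end Platypus

namespace Platypus

/-! ### Chains on which consensus works -/

section Chain

variable {P Tx : Type*} {byz members : Finset P} {log : ℕ → P → List (List Tx)}
  {pool : ℕ → Set (P × Tx)} {valid : List Tx → Tx → Prop}

/-- The chain is append-only and has the guarantees of a Byzantine fault tolerant consensus. -/
structure SoundChain (byz members : Finset P) (log : ℕ → P → List (List Tx))
    (pool : ℕ → Set (P × Tx)) (valid : List Tx → Tx → Prop) : Prop where
  mono : ∀ p t t', t ≤ t' → log t p <+: log t' p
  agree : ∀ p ∈ members \ byz, ∀ q ∈ members \ byz, ∀ (t t' h : ℕ) (b b' : List Tx),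
      (log t p)[h]? = some b → (log t' q)[h]? = some b' → b = b'
  sound : ∀ p ∈ members \ byz, ∀ t, ValidFrom valid [] (log t p).flatten ∧
      ∀ x ∈ (log t p).flatten, ∃ r, (r, x) ∈ pool t
  spread : ∀ p ∈ members \ byz, ∀ q ∈ members \ byz, ∀ t h,
      h < (log t p).length → ∃ t', h < (log t' q).length
  live : ∀ p ∉ byz, ∀ t x, (p, x) ∈ pool t →
      (∃ t₀, ∀ t' ≥ t₀, ∀ q ∈ members \ byz,
        x ∈ (log t' q).flatten ∨ valid (log t' q).flatten x) →
      ∃ t', ∃ q ∈ members \ byz, x ∈ (log t' q).flatten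

theorem UnforkableBFT.soundChain {V : Finset P} (h : UnforkableBFT byz V members log pool valid)
    (hV : 3 * (byz ∩ V).card < V.card) (mono : ∀ p t t', t ≤ t' → log t p <+: log t' p) :
    SoundChain byz members log pool valid :=
  ⟨mono, (h hV).1, (h hV).2.1, (h hV).2.2.1, (h hV).2.2.2⟩

namespace SoundChain

/-- Agreement at each height makes the logs of correct users comparable, so only their lengths
matter. -/
theorem prefix_of_length_le (hc : SoundChain byz members log pool valid) {p q : P}
    (hp : p ∈ members \ byz) (hq : q ∈ members \ byz) {t t' : ℕ}
    (h : (log t p).length ≤ (log t' q).length) : log t p <+: log t' q := by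
  rw [List.prefix_iff_eq_take]
  apply List.ext_getElem?
  intro i
  by_cases hi : i < (log t p).length
  · rw [List.getElem?_take_of_lt hi, List.getElem?_eq_getElem hi,
      List.getElem?_eq_getElem (hi.trans_le h)]
    exact congrArg some (hc.agree p hp q hq t t' i _ _ (List.getElem?_eq_getElem hi)
      (List.getElem?_eq_getElem (hi.trans_le h)))
  · rw [List.getElem?_eq_none (by omega), List.getElem?_eq_none (by simp; omega)]

theorem prefix_or_prefix (hc : SoundChain byz members log pool valid) {p q : P}
    (hp : p ∈ members \ byz) (hq : q ∈ members \ byz) (t t' : ℕ) :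
    log t p <+: log t' q ∨ log t' q <+: log t p :=
  (le_total _ _).imp (hc.prefix_of_length_le hp hq) (hc.prefix_of_length_le hq hp)

theorem exists_prefix (hc : SoundChain byz members log pool valid) {p q : P}
    (hp : p ∈ members \ byz) (hq : q ∈ members \ byz) (t : ℕ) :
    ∃ t', log t p <+: log t' q := by
  -- The property `spread` speaks of an occupied height, here the top one, length minus one; an
  -- empty log has none and is treated apart.
  rcases Nat.eq_zero_or_pos (log t p).length with h0 | h0
  · exact ⟨0, by rw [List.length_eq_zero_iff.1 h0]; exact List.nil_prefix⟩
  · obtain ⟨t', ht'⟩ := hc.spread p hp q hq t ((log t p).length - 1) (by omega)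
    exact ⟨t', hc.prefix_of_length_le hp hq (by omega)⟩

theorem eventually_prefix (hc : SoundChain byz members log pool valid) {p q : P}
    (hp : p ∈ members \ byz) (hq : q ∈ members \ byz) (t : ℕ) :
    ∀ᶠ t' in Filter.atTop, log t p <+: log t' q := by
  obtain ⟨t₀, h⟩ := hc.exists_prefix hp hq t
  filter_upwards [Filter.eventually_ge_atTop t₀] with t' ht'
  exact h.trans (hc.mono q t₀ t' ht')

/-- There are finitely many users, so one time serves for all of them. -/
theorem eventually_all_prefix (hc : SoundChain byz members log pool valid) {p : P}
    (hp : p ∈ members \ byz) (t : ℕ) :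
    ∀ᶠ t' in Filter.atTop, ∀ q ∈ members \ byz, log t p <+: log t' q :=
  (Filter.eventually_all_finset _).2 fun _ hq => hc.eventually_prefix hp hq t

theorem eventually_mem (hc : SoundChain byz members log pool valid) {p : P}
    (hp : p ∈ members \ byz) {t : ℕ} {x : Tx} (hx : x ∈ (log t p).flatten) :
    ∀ᶠ t' in Filter.atTop, ∀ q ∈ members \ byz, x ∈ (log t' q).flatten := by
  filter_upwards [hc.eventually_all_prefix hp t] with t' ht' q hq
  exact (ht' q hq).flatten.subset hx

/-- What two correct users have recorded is eventually recorded in one log. -/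
theorem exists_common (hc : SoundChain byz members log pool valid) {p q : P}
    (hp : p ∈ members \ byz) (hq : q ∈ members \ byz) (t t' : ℕ) :
    ∃ t'', (log t p).flatten <+: (log t'' p).flatten ∧
      (log t' q).flatten <+: (log t'' p).flatten := by
  obtain ⟨t₁, h⟩ := hc.exists_prefix hq hp t'
  exact ⟨max t t₁, (hc.mono p _ _ (le_max_left _ _)).flatten,
    (h.trans (hc.mono p _ _ (le_max_right _ _))).flatten⟩

/-- Liveness puts the transaction into the log of one correct user, and spreading carries it to all
the others. -/
theorem eventually_written (hc : SoundChain byz members log pool valid) {p : P} (hp : p ∉ byz)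
    {t : ℕ} {x : Tx} (hx : (p, x) ∈ pool t)
    (h : ∀ᶠ t' in Filter.atTop, ∀ q ∈ members \ byz,
      x ∈ (log t' q).flatten ∨ valid (log t' q).flatten x) :
    ∀ᶠ t' in Filter.atTop, ∀ q ∈ members \ byz, x ∈ (log t' q).flatten := by
  obtain ⟨t', q, hq, hx⟩ := hc.live p hp t x hx (Filter.eventually_atTop.1 h)
  exact hc.eventually_mem hq hx

end SoundChain

theorem ValidFrom.valid_of_append {H l l₁ l₂ : List Tx} {x : Tx} (h : ValidFrom valid H l)
    (hl : l = l₁ ++ x :: l₂) : valid (H ++ l₁) x := by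
  subst hl
  induction l₁ generalizing H with
  | nil => simpa using h.1
  | cons y l₁ ih => simpa using ih h.2

theorem ValidFrom.exists_of_mem {l : List Tx} {x : Tx} (h : ValidFrom valid [] l) (hx : x ∈ l) :
    ∃ l₁ l₂, l = l₁ ++ x :: l₂ ∧ valid l₁ x := by
  obtain ⟨l₁, l₂, rfl⟩ := List.append_of_mem hx
  exact ⟨l₁, l₂, rfl, by simpa using h.valid_of_append rfl⟩

end Chain

/-! ### Ownership in the childchain -/

variable {P Acct Coin : Type*}

theorem ownersAfter_append (base : Owners Acct Coin) (a b : List (Transfer Acct Coin)) :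
    ownersAfter base (a ++ b) = ownersAfter (ownersAfter base a) b := by
  simp [ownersAfter]

theorem ownersAfter_concat (base : Owners Acct Coin) (a : List (Transfer Acct Coin))
    (tr : Transfer Acct Coin) :
    ownersAfter base (a ++ [tr]) tr.coin = some tr.dst := by
  simp [ownersAfter]

theorem ownersAfter_eq_or (base : Owners Acct Coin) (a : List (Transfer Acct Coin)) (c : Coin) :
    ownersAfter base a c = base c ∨
      ∃ tr ∈ a, tr.coin = c ∧ ownersAfter base a c = some tr.dst := by
  induction a using List.reverseRecOn with
  | nil => exact Or.inl rfl
  | append_singleton a tr ih =>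
    by_cases hc : tr.coin = c
    · subst hc
      exact Or.inr ⟨tr, by simp, rfl, ownersAfter_concat _ _ _⟩
    · have e : ownersAfter base (a ++ [tr]) c = ownersAfter base a c := by
        simp [ownersAfter, Function.update_of_ne (Ne.symm hc)]
      rw [e]
      refine ih.imp id ?_
      rintro ⟨tr', h, h'⟩
      exact ⟨tr', by simp [h], h'⟩

/-- Every transfer is made by the owner of the coin, to an account that has not held it. -/
def FreshTransfers (base : Owners Acct Coin) (seq : List (Transfer Acct Coin)) : Prop :=
  ∀ a tr b, seq = a ++ tr :: b → ownersAfter base a tr.coin = some tr.src ∧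
    base tr.coin ≠ some tr.dst ∧ ∀ tr' ∈ a, tr'.coin = tr.coin → tr'.dst ≠ tr.dst

/-- The last transfer of a nonempty `b` hands its coin to an account that neither held it initially
nor received it in `a`. The final owner of that coin thus differs from its owner after `a`, so
ownership never returns to an earlier state. -/
theorem FreshTransfers.eq_nil {base : Owners Acct Coin} {a b : List (Transfer Acct Coin)}
    (h : FreshTransfers base (a ++ b)) (he : ownersAfter base a = ownersAfter base (a ++ b)) :
    b = [] := by
  induction b using List.reverseRecOn with
  | nil => rfl
  | append_singleton b tr _ =>
    obtain ⟨-, h1, h2⟩ := h (a ++ b) tr [] (by simp)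
    have e := congrFun he tr.coin
    rw [← List.append_assoc, ownersAfter_concat] at e
    rcases ownersAfter_eq_or base a tr.coin with h3 | ⟨tr', h3, h4, h5⟩
    · exact absurd (h3.symm.trans e) h1
    · exact absurd (Option.some.inj (h5.symm.trans e)) (h2 tr' (by simp [h3]) h4)

theorem FreshTransfers.of_prefix {base : Owners Acct Coin} {a b : List (Transfer Acct Coin)}
    (h : FreshTransfers base b) (hab : a <+: b) : FreshTransfers base a := by
  obtain ⟨c, rfl⟩ := hab
  rintro a' tr b' rfl
  exact h a' tr (b' ++ c) (by simp)

/-- A history of fresh transfers is determined by the resulting owners. -/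
theorem FreshTransfers.prefix_injective {base : Owners Acct Coin}
    {a b l : List (Transfer Acct Coin)} (h : FreshTransfers base l) (ha : a <+: l) (hb : b <+: l)
    (he : ownersAfter base a = ownersAfter base b) : a = b := by
  rcases List.prefix_or_prefix_of_prefix ha hb with ⟨c, rfl⟩ | ⟨c, rfl⟩
  · simp [(h.of_prefix hb).eq_nil he]
  · simp [(h.of_prefix ha).eq_nil he.symm]

theorem transfers_append (H H' : List (ChildTx P Acct Coin)) :
    transfers (H ++ H') = transfers H ++ transfers H' := by
  simp [transfers]

theorem mem_transfers {H : List (ChildTx P Acct Coin)} {tr : Transfer Acct Coin} :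
    tr ∈ transfers H ↔ ChildTx.pay tr ∈ H := by
  simp only [transfers, List.mem_filterMap]
  constructor
  · rintro ⟨x, hx, h⟩
    cases x <;> simp_all
  · exact fun h => ⟨_, h, rfl⟩

theorem transfers_prefix {H H' : List (ChildTx P Acct Coin)} (h : H <+: H') :
    transfers H <+: transfers H' := by
  obtain ⟨l, rfl⟩ := h
  exact ⟨transfers l, (transfers_append _ _).symm⟩

theorem exists_of_transfers_eq {H : List (ChildTx P Acct Coin)}
    {a b : List (Transfer Acct Coin)} {tr : Transfer Acct Coin}
    (h : transfers H = a ++ tr :: b) :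
    ∃ H₁ H₂, H = H₁ ++ ChildTx.pay tr :: H₂ ∧ transfers H₁ = a := by
  induction H generalizing a with
  | nil => simp [transfers] at h
  | cons x H ih =>
    cases x with
    | pay tr' =>
      change tr' :: transfers H = a ++ tr :: b at h
      cases a with
      | nil =>
        obtain ⟨rfl, -⟩ : tr' = tr ∧ _ := by simpa using h
        exact ⟨[], H, rfl, rfl⟩
      | cons y a =>
        obtain ⟨rfl, h'⟩ : tr' = y ∧ transfers H = a ++ tr :: b := by simpa using h
        obtain ⟨H₁, H₂, rfl, rfl⟩ := ih h'
        exact ⟨ChildTx.pay tr' :: H₁, H₂, rfl, rfl⟩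
    | close cl S =>
      obtain ⟨H₁, H₂, rfl, rfl⟩ := ih h
      exact ⟨ChildTx.close cl S :: H₁, H₂, rfl, rfl⟩
    | abort ab =>
      obtain ⟨H₁, H₂, rfl, rfl⟩ := ih h
      exact ⟨ChildTx.abort ab :: H₁, H₂, rfl, rfl⟩

variable {G : Setup P Acct Coin} {ct : CreateTx P Acct Coin}

theorem freshTransfers_of_valid {H : List (ChildTx P Acct Coin)}
    (h : ValidFrom (childValid G ct) [] H) : FreshTransfers ct.balances (transfers H) := by
  intro a tr b hab
  obtain ⟨H₁, H₂, rfl, rfl⟩ := exists_of_transfers_eq hab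
  have := h.valid_of_append rfl
  exact ⟨this.2.1, this.2.2.1, this.2.2.2.1⟩

/-- A bulk close in a valid childchain names the owners after all transfers recorded. -/
theorem close_eq_ownersAfter {H : List (ChildTx P Acct Coin)}
    (h : ValidFrom (childValid G ct) [] H) {cl : Owners Acct Coin} {S : Finset P}
    (hx : ChildTx.close cl S ∈ H) :
    Quorum ct S ∧ cl = ownersAfter ct.balances (transfers H) := by
  obtain ⟨H₁, H₂, rfl, hv⟩ := h.exists_of_mem hx
  refine ⟨hv.2.1, hv.2.2.trans ?_⟩
  -- A payment is invalid once a bulk close is in the history, so nothing after the close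
  -- contributes a transfer.
  have h0 : transfers (ChildTx.close cl S :: H₂) = [] := by
    refine List.eq_nil_iff_forall_not_mem.2 fun tr htr => ?_
    rw [mem_transfers, List.mem_cons] at htr
    rcases htr with htr | htr
    · cases htr
    · obtain ⟨H₃, H₄, rfl⟩ := List.append_of_mem htr
      have := h.valid_of_append (l₁ := H₁ ++ ChildTx.close cl S :: H₃)
        (x := ChildTx.pay tr) (l₂ := H₄) (by simp)
      exact this.1 cl S (by simp)
  rw [transfers_append, h0, List.append_nil]

/-! ### The parentchain -/

theorem creation_of_prefix {H H' : List (ParentTx P Acct Coin)} (h : H <+: H')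
    (hc : creation H = some ct) : creation H' = some ct := by
  obtain ⟨l, rfl⟩ := h
  unfold creation at *
  rw [List.filterMap_append, List.head?_append, hc]
  rfl

theorem exists_create_of_creation {H : List (ParentTx P Acct Coin)}
    (hc : creation H = some ct) : ∃ S, ParentTx.create ct S ∈ H := by
  unfold creation at hc
  have := List.mem_of_head? hc
  rw [List.mem_filterMap] at this
  obtain ⟨x, hx, h⟩ := this
  cases x <;> simp_all
  exact ⟨_, hx⟩

theorem creation_ne_none_of_mem {H : List (ParentTx P Acct Coin)} {S : Finset P}
    (h : ParentTx.create ct S ∈ H) : creation H ≠ none := by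
  unfold creation
  rw [Ne, List.head?_eq_none_iff, List.filterMap_eq_nil_iff]
  intro h'
  simpa using h' _ h

theorem parent_close_valid {H : List (ParentTx P Acct Coin)}
    (h : ValidFrom (parentValid G) [] H) {cl : Owners Acct Coin} {S T : Finset P}
    (hx : ParentTx.close cl S T ∈ H) :
    ∃ ct, creation H = some ct ∧ Quorum ct S ∧ Quorum ct T := by
  obtain ⟨H₁, H₂, rfl, -, ct, hc, hS, hT⟩ := h.exists_of_mem hx
  exact ⟨ct, creation_of_prefix (List.prefix_append _ _) hc, hS, hT⟩

/-- No abort transaction is written in the parentchain after a bulk close. -/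
theorem mem_sinceLastAbort {H : List (ParentTx P Acct Coin)}
    (h : ValidFrom (parentValid G) [] H) {cl : Owners Acct Coin} {S T : Finset P}
    (hx : ParentTx.close cl S T ∈ H) : ParentTx.close cl S T ∈ sinceLastAbort H := by
  obtain ⟨H₁, H₂, rfl⟩ := List.append_of_mem hx
  -- An abort transaction is valid in the parentchain only before closure, so the whole suffix from
  -- the bulk close on survives `rtakeWhile`.
  have h0 : ∀ x ∈ ParentTx.close cl S T :: H₂, (!isAbort x) = true := by
    intro x hx
    rcases List.mem_cons.1 hx with rfl | hx
    · rfl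
    · cases x with
      | abort ab =>
        obtain ⟨H₃, H₄, rfl⟩ := List.append_of_mem hx
        have := h.valid_of_append (l₁ := H₁ ++ ParentTx.close cl S T :: H₃)
          (x := ParentTx.abort ab) (l₂ := H₄) (by simp)
        exact absurd ⟨cl, S, T, by simp⟩ this.1
      | _ => rfl
  unfold sinceLastAbort
  rw [List.rtakeWhile, List.mem_reverse, List.reverse_append,
    List.takeWhile_append_of_pos fun x hx => h0 x (List.mem_reverse.1 hx)]
  simp

theorem not_isAbort_of_mem_sinceLastAbort {H : List (ParentTx P Acct Coin)}
    {x : ParentTx P Acct Coin} (h : x ∈ sinceLastAbort H) : x ∈ H ∧ isAbort x = false := by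
  refine ⟨(List.rtakeWhile_suffix _ _).subset h, ?_⟩
  simpa using List.mem_rtakeWhile_imp h

end Platypus

namespace Platypus

variable {P Acct Coin : Type*} {G : Setup P Acct Coin} {E : ℕ → State P Acct Coin}
  {ct : CreateTx P Acct Coin}

/-! ### Quorums -/

/-- From $f<n/3$ one gets $n-f>2n/3$, hence $n-f\ge\lfloor 2n/3\rfloor+1$: the correct validators
suffice on their own. -/
theorem threshold_le_card_sdiff {V byz : Finset P} (h : 3 * byz.card < V.card) :
    threshold V.card ≤ (V \ byz).card := by
  have h1 := Finset.le_card_sdiff byz V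
  unfold threshold
  omega

/-- The threshold exceeds $2n/3$, more than the number of Byzantine users, so they cannot fill a
quorum. -/
theorem exists_correct_of_threshold_le {V byz S : Finset P} (h : 3 * byz.card < V.card)
    (hS : threshold V.card ≤ (S ∩ V).card) : ∃ v ∈ S, v ∈ V ∧ v ∉ byz := by
  have h1 : byz.card < (S ∩ V).card := by
    unfold threshold at hS
    omega
  obtain ⟨v, hv, hb⟩ := Finset.exists_mem_notMem_of_card_lt_card h1
  exact ⟨v, (Finset.mem_inter.1 hv).1, (Finset.mem_inter.1 hv).2, hb⟩

/-- Signatures accumulate: if each correct validator who gets a request signed by `S` passes it on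
with its own signature, or achieves `D` once there are enough signatures, then `D` is achieved. -/
theorem of_signatures_accumulate {C V : Finset P} {n : ℕ} (hCV : C ⊆ V) (hn : n ≤ C.card)
    (hC : C.Nonempty) {M : Finset P → Prop} {D : Prop}
    (h : ∀ S, M S → ∀ v ∈ C, D ∨ (M (insert v S) ∧ (insert v S ∩ V).card < n))
    {S : Finset P} (hS : M S) : D := by
  induction hk : n - (S ∩ V).card using Nat.strong_induction_on generalizing S with
  | _ k ih =>
    -- If all correct validators have signed, there are already `n` signatures and the second
    -- alternative is impossible. Otherwise a correct validator outside `S` adds a new signature,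
    -- and the number still missing drops.
    by_cases hCS : C ⊆ S
    · obtain ⟨v, hv⟩ := hC
      refine (h S hS v hv).elim id fun h' => ?_
      have h1 : C ⊆ insert v S ∩ V :=
        Finset.subset_inter (hCS.trans (Finset.subset_insert _ _)) hCV
      have := Finset.card_le_card h1
      omega
    · obtain ⟨v, hv, hvS⟩ := Finset.not_subset.1 hCS
      refine (h S hS v hv).elim id fun h' => ?_
      have h1 : (insert v S ∩ V).card = (S ∩ V).card + 1 := by
        rw [Finset.insert_inter_of_mem (hCV hv), Finset.card_insert_of_notMem]
        simp [hvS]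
      exact ih _ (by omega) h'.1 rfl

theorem CreateTx.validators_subset_members (ct : CreateTx P Acct Coin) :
    ct.validators ⊆ ct.members :=
  Finset.image_subset_image (Finset.filter_subset _ _)

theorem getElem?_of_prefix {X : Type*} {l l' : List X} {h : ℕ} {b : X} (hl : l <+: l')
    (hb : l[h]? = some b) : l'[h]? = some b := by
  obtain ⟨r, rfl⟩ := hl
  rw [List.getElem?_append_left (List.getElem?_eq_some_iff.1 hb).1, hb]

/-! ### Runs -/

/-- An execution over a reliable network and a sound parentchain, with few Byzantine users. -/
structure Run [Fintype P] (G : Setup P Acct Coin) (E : ℕ → State P Acct Coin) : Prop where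
  few : 3 * G.byz.card < G.mv
  exec : Execution G E
  delivery : ∀ i q m, q ∉ G.byz → (q, m) ∈ (E i).sent → ∃ j, m ∈ (E j).rcvd q
  parent : SoundChain G.byz Finset.univ (fun t => (E t).parent) (fun t => (E t).parentPool)
    (parentValid G)

/-- The bounds of partial synchrony enter only through eventual delivery: the time of the steps
tends to infinity and so passes every deadline. -/
theorem PartialSynchrony.delivery (h : PartialSynchrony G E) (i : ℕ) (q : P)
    (m : Msg P Acct Coin) (hq : q ∉ G.byz) (hm : (q, m) ∈ (E i).sent) :
    ∃ j, m ∈ (E j).rcvd q := by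
  obtain ⟨τ, -, hτ, GST, Δ, -, h⟩ := h
  obtain ⟨j, hj⟩ := (hτ.eventually (Filter.eventually_gt_atTop (max (τ i) GST + Δ))).exists
  exact ⟨j, h i q m hq hm j hj⟩

namespace Run

variable [Fintype P]

theorem mem_correct {p : P} (hp : p ∉ G.byz) : p ∈ Finset.univ \ G.byz := by simp [hp]

theorem eventually_rcvd (hr : Run G E) {i : ℕ} {q : P} {m : Msg P Acct Coin} (hq : q ∉ G.byz)
    (hm : (q, m) ∈ (E i).sent) : ∀ᶠ t in Filter.atTop, m ∈ (E t).rcvd q := by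
  obtain ⟨j, hj⟩ := hr.delivery i q m hq hm
  filter_upwards [Filter.eventually_ge_atTop j] with t ht
  exact (hr.exec.le ht).rcvd q hj

theorem creation_unique (hr : Run G E) {p q : P} (hp : p ∉ G.byz) (hq : q ∉ G.byz) {t t' : ℕ}
    {ct' : CreateTx P Acct Coin} (h : creation ((E t).parentLog p) = some ct)
    (h' : creation ((E t').parentLog q) = some ct') : ct = ct' := by
  obtain ⟨t'', h1, h2⟩ := hr.parent.exists_common (mem_correct hp) (mem_correct hq) t t'
  exact Option.some.inj ((creation_of_prefix h1 h).symm.trans (creation_of_prefix h2 h'))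

theorem eventually_creation (hr : Run G E) {p : P} (hp : p ∉ G.byz) {t : ℕ}
    (h : creation ((E t).parentLog p) = some ct) :
    ∀ᶠ t' in Filter.atTop, ∀ q ∉ G.byz, creation ((E t').parentLog q) = some ct := by
  filter_upwards [hr.parent.eventually_all_prefix (mem_correct hp) t] with t' ht' q hq
  exact creation_of_prefix (ht' q (mem_correct hq)).flatten h

theorem parent_valid (hr : Run G E) {p : P} (hp : p ∉ G.byz) (t : ℕ) :
    ValidFrom (parentValid G) [] ((E t).parentLog p) :=
  (hr.parent.sound p (mem_correct hp) t).1

theorem parent_sent (hr : Run G E) {p : P} (hp : p ∉ G.byz) {t : ℕ} {x : ParentTx P Acct Coin}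
    (hx : x ∈ (E t).parentLog p) : ∃ r, (r, x) ∈ (E t).parentPool :=
  (hr.parent.sound p (mem_correct hp) t).2 x hx

theorem bootstrapped (hr : Run G E) (h : Created G E ct) : Bootstrapped G E ct := by
  obtain ⟨t, p, hp, hc⟩ := h
  obtain ⟨S, hS⟩ := exists_create_of_creation hc
  obtain ⟨r, hrS⟩ := hr.parent_sent hp hS
  obtain ⟨hj, hsig⟩ := (hr.exec.authentic t).create r ct S hrS
  obtain ⟨H₁, H₂, -, -, hth, -⟩ := (hr.parent_valid hp t).exists_of_mem hS
  refine ⟨?_, ⟨t, S, hth, ⟨p, hp, hS⟩, hsig⟩, fun j hjm hb => ⟨t, hj j hjm j.sender (by simp) hb⟩⟩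
  have hlt : G.byz.card < (S ∩ ct.validators).card := by
    have := hr.few
    unfold threshold at hth
    omega
  obtain ⟨v, hv, hb⟩ := Finset.exists_mem_notMem_of_card_lt_card hlt
  exact hr.exec.signed_create (hsig v (Finset.mem_inter.1 hv).1 hb)

end Run

/-! ### Bulk close and abort in a created childchain. -/

/-- A run in which a childchain is created, itself a sound chain. -/
structure ChildRun [Fintype P] (G : Setup P Acct Coin) (E : ℕ → State P Acct Coin)
    (ct : CreateTx P Acct Coin) : Prop extends Run G E where
  created : Created G E ct
  child : SoundChain G.byz ct.members (fun t => (E t).child) (fun t => (E t).childPool)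
    (childValid G ct)

namespace ChildRun

theorem validator_correct {v : P} (h : v ∈ ct.validators \ G.byz) :
    v ∈ ct.members \ G.byz :=
  Finset.sdiff_subset_sdiff ct.validators_subset_members subset_rfl h

variable [Fintype P]

theorem few_validators (hr : ChildRun G E ct) : 3 * G.byz.card < ct.validators.card := by
  rw [(hr.bootstrapped hr.created).validators_card]
  exact hr.few

theorem nonempty (hr : ChildRun G E ct) : (ct.validators \ G.byz).Nonempty := by
  rw [← Finset.card_pos]
  have := threshold_le_card_sdiff hr.few_validators
  unfold threshold at this
  omega

/-- This quorum is the certificate used in every attestation constructed below. -/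
theorem quorum (hr : ChildRun G E ct) : Quorum ct (ct.validators \ G.byz) := by
  unfold Quorum
  rw [Finset.inter_eq_left.2 Finset.sdiff_subset]
  exact threshold_le_card_sdiff hr.few_validators

theorem exists_correct (hr : ChildRun G E ct) {S : Finset P} (hS : Quorum ct S) :
    ∃ v ∈ S, v ∈ ct.members \ G.byz := by
  obtain ⟨v, hv, hV, hb⟩ := exists_correct_of_threshold_le hr.few_validators hS
  exact ⟨v, hv, validator_correct (Finset.mem_sdiff.2 ⟨hV, hb⟩)⟩

theorem creation_eq (hr : ChildRun G E ct) {p : P} (hp : p ∉ G.byz) {t : ℕ}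
    {ct' : CreateTx P Acct Coin} (h : creation ((E t).parentLog p) = some ct') : ct' = ct := by
  obtain ⟨_, _, hq, h'⟩ := hr.created
  exact hr.creation_unique hp hq h h'

theorem eventually_inChild (hr : ChildRun G E ct) :
    ∀ᶠ t in Filter.atTop, ∀ q ∈ ct.members \ G.byz, InChild (E t) q ct := by
  obtain ⟨t₀, p, hp, h⟩ := hr.created
  filter_upwards [hr.eventually_creation hp h] with t ht q hq
  exact ⟨ht q (Finset.mem_sdiff.1 hq).2, (Finset.mem_sdiff.1 hq).1⟩

theorem inChild (hr : ChildRun G E ct) {p : P} (hp : p ∉ G.byz) {t : ℕ}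
    {ct' : CreateTx P Acct Coin} (h : InChild (E t) p ct') :
    ct' = ct ∧ p ∈ ct.members \ G.byz := by
  obtain rfl := hr.creation_eq hp h.1
  exact ⟨rfl, Finset.mem_sdiff.2 ⟨h.2, hp⟩⟩

theorem child_valid (hr : ChildRun G E ct) {p : P} (hp : p ∈ ct.members \ G.byz) (t : ℕ) :
    ValidFrom (childValid G ct) [] ((E t).childLog p) :=
  (hr.child.sound p hp t).1

theorem fresh (hr : ChildRun G E ct) {p : P} (hp : p ∈ ct.members \ G.byz) (t : ℕ) :
    FreshTransfers ct.balances (transfers ((E t).childLog p)) :=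
  freshTransfers_of_valid (hr.child_valid hp t)

/-- Both sequences are prefixes of the transfers in one common log, where the resulting owners
determine the prefix. -/
theorem lists_unique (hr : ChildRun G E ct) {cl : Owners Acct Coin}
    {a b : List (Transfer Acct Coin)} (ha : Lists G E ct cl a) (hb : Lists G E ct cl b) :
    a = b := by
  obtain ⟨⟨t, p, hp, hta⟩, hcl⟩ := ha
  obtain ⟨⟨t', q, hq, htb⟩, hcl'⟩ := hb
  obtain ⟨t'', h1, h2⟩ := hr.child.exists_common hp hq t t'
  exact (hr.fresh hp t'').prefix_injective (hta.trans (transfers_prefix h1))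
    (htb.trans (transfers_prefix h2)) (hcl.symm.trans hcl')

theorem close_unique (hr : ChildRun G E ct) {p q : P} (hp : p ∈ ct.members \ G.byz)
    (hq : q ∈ ct.members \ G.byz) {t t' : ℕ} {cl cl' : Owners Acct Coin} {S S' : Finset P}
    (h : ChildTx.close cl S ∈ (E t).childLog p) (h' : ChildTx.close cl' S' ∈ (E t').childLog q) :
    cl = cl' := by
  obtain ⟨t'', h1, h2⟩ := hr.child.exists_common hp hq t t'
  rw [(close_eq_ownersAfter (hr.child_valid hp t'') (h1.subset h)).2,
    (close_eq_ownersAfter (hr.child_valid hp t'') (h2.subset h')).2]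

/-- A bulk close written in the childchain is committed by all correct users of it. -/
theorem decides_commit (hr : ChildRun G E ct) {p q : P} (hp : p ∈ ct.members \ G.byz)
    (hq : q ∈ ct.members \ G.byz) {t : ℕ} {cl : Owners Acct Coin} {S : Finset P}
    (h : ChildTx.close cl S ∈ (E t).childLog p) : Decides E q Verdict.commit cl := by
  -- Eventually all correct validators have the bulk close in their logs, so they can attest it;
  -- from then on the rule stays enabled.
  have h1 : ∀ᶠ t' in Filter.atTop,
      CommitEnabled G (E t') q ct cl S (ct.validators \ G.byz) := by
    filter_upwards [hr.eventually_inChild, hr.child.eventually_mem hp h] with t' hi hm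
    exact ⟨hi q hq, hm q hq, hr.quorum, fun v hv _ => hm v (validator_correct hv)⟩
  obtain ⟨t₀, h1⟩ := Filter.eventually_atTop.1 h1
  obtain ⟨t', ht', h2⟩ := hr.exec.fair.decideCommit q (Finset.mem_sdiff.1 hq).2 ct cl t₀
  exact ⟨t', h2 ⟨_, _, h1 t' ht'⟩⟩

/-- If a correct user proposes ABORT, all correct users of the childchain decide ABORT. -/
theorem decides_abort (hr : ChildRun G E ct) {p q : P} (hp : p ∉ G.byz)
    (hq : q ∈ ct.members \ G.byz) {cl : Owners Acct Coin} (h : ProposesAbort E p cl) :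
    Decides E q Verdict.abort cl := by
  obtain ⟨t, ab, rfl, hab⟩ := h
  obtain ⟨i, ct', cl', S, hi, -, rfl, -, hcl, ⟨b, hb, hpay⟩, -⟩ :=
    hr.exec.childPool_abort hp hab
  obtain ⟨rfl, hpm⟩ := hr.inChild hp hi
  have hmem : ChildTx.pay ab.spend ∈ (E i).childLog p :=
    List.mem_flatten.2 ⟨b, List.mem_of_getElem? hb, hpay⟩
  -- Validity of an abort transaction only asks that the payment be in the history. It is thus
  -- permanent once the payment has reached all correct logs, even after a bulk close.
  have h1 : ∀ᶠ t' in Filter.atTop, AbortDecisionEnabled (E t') q ct' ab := by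
    filter_upwards [hr.eventually_inChild, hr.child.eventually_written hp hab
      ((hr.child.eventually_mem hpm hmem).mono fun t' ht' r hrm => Or.inr ⟨ht' r hrm, hcl⟩)]
      with t' hi hm
    exact ⟨hi q hq, hm q hq⟩
  obtain ⟨t₀, h1⟩ := Filter.eventually_atTop.1 h1
  obtain ⟨t', ht', h2⟩ := hr.exec.fair.decideAbort q (Finset.mem_sdiff.1 hq).2 ct' ab t₀
  exact ⟨t', h2 (h1 t' ht')⟩

/-- A correct user who has received a bulk close in which a coin is spent proposes ABORT. -/
theorem proposesAbort (hr : ChildRun G E ct) {p v : P} (hp : p ∈ ct.members \ G.byz)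
    (hv : v ∈ ct.members \ G.byz) {cl : Owners Acct Coin} {S : Finset P} {i t : ℕ}
    (hS : Msg.closeReq cl S ∈ (E i).rcvd v) {tr : Transfer Acct Coin}
    (hcl : cl tr.coin = some tr.src) (htr : ChildTx.pay tr ∈ (E t).childLog p) :
    ProposesAbort E v cl := by
  obtain ⟨t₁, ht₁⟩ := (hr.child.eventually_mem hp htr).exists
  -- The least height of a fraudulent payment is fixed in the log at time `t₁`. Later logs extend
  -- this one, so it stays the least height.
  have hex : ∃ h : ℕ, ∃ (b : List (ChildTx P Acct Coin)) (tr : Transfer Acct Coin), ((E t₁).child v)[h]? = some b ∧ ChildTx.pay tr ∈ b ∧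
      cl tr.coin = some tr.src := by
    obtain ⟨b, hb, hpay⟩ := List.mem_flatten.1 (ht₁ v hv)
    obtain ⟨h, hh⟩ := List.mem_iff_getElem?.1 hb
    exact ⟨h, b, tr, hh, hpay, hcl⟩
  obtain ⟨b, tr', hb, hpay, hcl'⟩ := Nat.find_spec hex
  have hlen : Nat.find hex < ((E t₁).child v).length := (List.getElem?_eq_some_iff.1 hb).1
  -- The abort transaction depends on `t'`, since its list of fraudsters must match the current
  -- length of the log; the fairness condition for aborts accordingly quantifies over it
  -- existentially.
  have hev : ∀ᶠ t' in Filter.atTop, ∃ ab, AbortEnabled G (E t') v ct cl S ab := by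
    filter_upwards [hr.eventually_inChild, hr.child.eventually_all_prefix hv t₁,
      Filter.eventually_ge_atTop i] with t' hin hpre hi
    -- `AbortFor` requires only that the listed validators did validate both items, so empty sets of
    -- fraudsters suffice. The certificate consists of the correct validators.
    refine ⟨⟨cl, S, Nat.find hex,
      List.replicate (((E t').child v).length - Nat.find hex) ∅, tr', ct.validators \ G.byz⟩,
      hin v hv, (hr.exec.le hi).rcvd v hS, rfl, rfl, hcl', ?_, ?_, hr.quorum, ?_, ?_, ?_⟩
    · exact ⟨b, getElem?_of_prefix (hpre v hv) hb, hpay⟩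
    · intro h hlt b' hb' tr'' htr'' hcl''
      refine Nat.find_min hex hlt ⟨b', tr'', ?_, htr'', hcl''⟩
      rw [List.getElem?_eq_getElem (hlt.trans hlen), (hpre v hv).getElem (hlt.trans hlen)]
      exact hb' ▸ (List.getElem?_eq_getElem _).symm
    · exact fun q hq _ => ⟨b, getElem?_of_prefix (hpre q (validator_correct hq)) hb, hpay⟩
    · simp
    · intro k F b' hF _
      obtain rfl : F = ∅ := List.eq_of_mem_replicate (List.mem_of_getElem? hF)
      simp
  obtain ⟨t₀, hev⟩ := Filter.eventually_atTop.1 hev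
  obtain ⟨t', ht', h2⟩ := hr.exec.fair.abort v (Finset.mem_sdiff.1 hv).2 ct cl S t₀
  obtain ⟨ab, hab, -, hab'⟩ := h2 (hev t' ht')
  exact ⟨t', ab, hab, hab'⟩

/-- If a request to sign the bulk close of all transfers ever made is sent to the validators, the
bulk close is eventually written. -/
theorem close_written (hr : ChildRun G E ct) {p : P} (hp : p ∈ ct.members \ G.byz) {i : ℕ}
    (hmax : ∀ t, ∀ q ∈ ct.members \ G.byz,
      transfers ((E t).childLog q) <+: transfers ((E i).childLog p))
    (h : (∃ j S, ∀ v ∈ ct.validators,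
        (v, Msg.closeReq (currentOwners (E i) p ct) S) ∈ (E j).sent) ∨
      ∃ j S, ∃ v ∉ G.byz, Quorum ct S ∧
        (v, ChildTx.close (currentOwners (E i) p ct) S) ∈ (E j).childPool) :
    ∃ t S, ∃ q ∈ ct.members \ G.byz,
      ChildTx.close (currentOwners (E i) p ct) S ∈ (E t).childLog q := by
  set cl := currentOwners (E i) p ct with hcl
  -- The assumption that the bulk close is never written is what keeps the signing rule enabled and
  -- the transaction valid.
  by_contra hno
  push Not at hno
  have hev : ∀ᶠ t in Filter.atTop, ∀ q ∈ ct.members \ G.byz,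
      transfers ((E t).childLog q) = transfers ((E i).childLog p) := by
    filter_upwards [hr.child.eventually_all_prefix hp i] with t ht q hq
    exact (List.prefix_iff_eq_take.1 (hmax t q hq)).trans
      (List.take_of_length_le (transfers_prefix (ht q hq).flatten).length_le)
  -- Any bulk close written names the owners after all transfers, which are eventually those of
  -- `cl`. Hence no other bulk close can block this one either.
  have hno' : ∀ t cl' S, ∀ q ∈ ct.members \ G.byz,
      ChildTx.close cl' S ∉ (E t).childLog q := by
    intro t cl' S q hq hm
    obtain ⟨t', h1, h2⟩ := ((hr.child.eventually_mem hq hm).and hev).exists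
    have h3 := (close_eq_ownersAfter (hr.child_valid hq t') (h1 q hq)).2
    rw [h2 q hq] at h3
    obtain rfl : cl' = cl := h3
    exact hno t S q hq hm
  have hprop : ∃ j S, ∃ v ∉ G.byz, Quorum ct S ∧
      (v, ChildTx.close cl S) ∈ (E j).childPool := by
    rcases h with h | h
    swap
    · exact h
    -- Starting from one request sent to all validators, every correct validator eventually signs
    -- and relays it, until a quorum of signatures is complete.
    obtain ⟨j, S, hS⟩ := h
    refine of_signatures_accumulate
      (M := fun S => ∃ j, ∀ v ∈ ct.validators, (v, Msg.closeReq cl S) ∈ (E j).sent)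
      (Finset.sdiff_subset (s := ct.validators) (t := G.byz))
      (threshold_le_card_sdiff hr.few_validators) hr.nonempty ?_ ⟨j, hS⟩
    rintro S ⟨j, hS⟩ v hv
    have hvm := validator_correct hv
    obtain ⟨hvV, hvb⟩ := Finset.mem_sdiff.1 hv
    have hen : ∀ᶠ t in Filter.atTop, SignCloseEnabled (E t) v ct cl S := by
      filter_upwards [hr.eventually_inChild, hev, hr.eventually_rcvd hvb (hS v hvV)]
        with t hin he hrc
      refine ⟨hin v hvm, hvV, hrc, fun S' => hno t S' v hvm, ?_⟩
      rw [hcl, currentOwners, currentOwners, he v hvm]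
    obtain ⟨t₀, hen⟩ := Filter.eventually_atTop.1 hen
    obtain ⟨t, ht, hd⟩ := hr.exec.fair.signClose v hvb ct cl S t₀
    have hd := hd (hen t ht)
    unfold SignCloseDone at hd
    split_ifs at hd with hQ
    · exact Or.inl ⟨t, _, v, hvb, hQ, hd⟩
    · exact Or.inr ⟨⟨t, hd⟩, not_le.1 hQ⟩
  obtain ⟨j, S, v, hv, hQ, hpool⟩ := hprop
  obtain ⟨t, ht⟩ := (hr.child.eventually_written hv hpool (hev.mono fun t ht q hq => Or.inr
    ⟨fun cl' S' => hno' t cl' S' q hq, hQ, by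
      rw [hcl, currentOwners]; exact congrArg _ (ht q hq).symm⟩)).exists
  exact hno t S p hp (ht p hp)

theorem lists_of_signed (hr : ChildRun G E ct) {p : P} (hp : p ∉ G.byz) {t : ℕ}
    {cl : Owners Acct Coin} (h : Stmt.close cl ∈ (E t).signed p) :
    ∃ seq, Lists G E ct cl seq := by
  obtain ⟨i, -, ct', hi, hcl, -⟩ := hr.exec.signed_close h
  obtain ⟨rfl, hpm⟩ := hr.inChild hp hi
  exact ⟨_, ⟨i, p, hpm, List.prefix_rfl⟩, hcl⟩

/-- A bulk close signed by a correct user is committed by all correct users of the childchain, or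
a correct user proposes ABORT for it. -/
theorem commit_or_proposesAbort (hr : ChildRun G E ct) {p : P} (hp : p ∉ G.byz) {t : ℕ}
    {cl : Owners Acct Coin} (h : Stmt.close cl ∈ (E t).signed p) :
    (∀ q ∈ ct.members \ G.byz, Decides E q Verdict.commit cl) ∨
      ∃ v ∉ G.byz, ProposesAbort E v cl := by
  obtain ⟨i, -, ct', hi, rfl, hor⟩ := hr.exec.signed_close h
  obtain ⟨rfl, hpm⟩ := hr.inChild hp hi
  -- The case distinction is whether the view of `p` at the time of signing contains every transfer
  -- that any correct user of the childchain ever records.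
  by_cases hmax : ∀ t, ∀ q ∈ ct'.members \ G.byz,
      transfers ((E t).childLog q) <+: transfers ((E i).childLog p)
  · left
    obtain ⟨t', S, q, hq, hm⟩ := hr.close_written hpm hmax
      (hor.imp (fun ⟨S, h⟩ => ⟨_, S, h⟩) fun ⟨_, S', _, h, h'⟩ => ⟨_, S', p, hp, h, h'⟩)
    exact fun q' hq' => hr.decides_commit hq hq' hm
  · right
    push Not at hmax
    obtain ⟨t', q, hq, hnot⟩ := hmax
    have hpre : transfers ((E i).childLog p) <+: transfers ((E t').childLog q) :=
      transfers_prefix ((hr.child.prefix_or_prefix hpm hq i t').resolve_right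
        fun h => hnot (transfers_prefix h.flatten)).flatten
    -- The head of the remainder `r` is the first transfer beyond the signed view. Its source is the
    -- owner named in the bulk close, so it is the fraudulent payment to exhibit.
    obtain ⟨r, hr'⟩ := hpre
    cases r with
    | nil => exact absurd (by rw [← hr', List.append_nil]) hnot
    | cons tr r =>
      have hcl := (hr.fresh hq t' _ tr r hr'.symm).1
      have htr : ChildTx.pay tr ∈ (E t').childLog q := by
        rw [← mem_transfers, ← hr']
        simp
      -- The accuser is a correct validator to whom the request was multicast, or else `p` itself,
      -- which had received a request before completing the quorum.
      rcases hor with ⟨S, hS⟩ | ⟨S, -, hS, -⟩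
      · obtain ⟨v, hv⟩ := hr.nonempty
        obtain ⟨hvV, hvb⟩ := Finset.mem_sdiff.1 hv
        obtain ⟨j, hj⟩ := hr.delivery _ v _ hvb (hS v hvV)
        exact ⟨v, hvb, hr.proposesAbort hq (validator_correct hv) hj hcl htr⟩
      · exact ⟨p, hp, hr.proposesAbort hq hpm hS hcl htr⟩

theorem signed_of_proposesCommit (hr : ChildRun G E ct) {r : P} {cl : Owners Acct Coin}
    (h : ProposesCommit E ct r cl) : ∃ p ∉ G.byz, ∃ t, Stmt.close cl ∈ (E t).signed p := by
  obtain ⟨t, S, hQ, hm⟩ := h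
  obtain ⟨v, hv, hvm⟩ := hr.exists_correct hQ
  have hb := (Finset.mem_sdiff.1 hvm).2
  exact ⟨v, hb, t, (hr.exec.authentic t).close r cl S hm v hv hb⟩

theorem written_of_commit (hr : ChildRun G E ct) {p : P} {cl : Owners Acct Coin}
    (h : Decides E p Verdict.commit cl) :
    ∃ t S T, p ∈ ct.members \ G.byz ∧ Quorum ct S ∧ Quorum ct T ∧
      ChildTx.close cl S ∈ (E t).childLog p ∧
      (p, ParentTx.close cl S T) ∈ (E (t + 1)).parentPool := by
  obtain ⟨t, h⟩ := h
  obtain ⟨i, hp, ct', S, T, ⟨hi, hm, hT, -⟩, hpool⟩ := hr.exec.decided_commit h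
  obtain ⟨rfl, hpm⟩ := hr.inChild hp hi
  exact ⟨i, S, T, hpm, (close_eq_ownersAfter (hr.child_valid hpm i) hm).1, hT, hm, hpool⟩

theorem proposed_of_commit (hr : ChildRun G E ct) {p : P} {cl : Owners Acct Coin}
    (h : Decides E p Verdict.commit cl) : ∃ r, ProposesCommit E ct r cl := by
  obtain ⟨t, S, T, hp, hS, -, hm, -⟩ := hr.written_of_commit h
  obtain ⟨r, hr'⟩ := (hr.child.sound p hp t).2 _ hm
  exact ⟨r, t, S, hS, hr'⟩

/-- A bulk close recorded in the parentchain is the one written in the childchain. -/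
theorem parent_close_eq (hr : ChildRun G E ct) {p q : P} (hq : q ∉ G.byz)
    {t : ℕ} {cl cl' : Owners Acct Coin} {S T : Finset P}
    (hp : Decides E p Verdict.commit cl) (h : ParentTx.close cl' S T ∈ (E t).parentLog q) :
    cl' = cl := by
  obtain ⟨t', S', T', hpm, -, -, hm, -⟩ := hr.written_of_commit hp
  obtain ⟨ct', hc, -, hT⟩ := parent_close_valid (hr.parent_valid hq t) h
  obtain rfl := hr.creation_eq hq hc
  obtain ⟨v, hv, hvm⟩ := hr.exists_correct hT
  obtain ⟨r, hpool⟩ := hr.parent_sent hq h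
  exact hr.close_unique hvm hpm
    ((hr.exec.authentic t).attested r cl' S T hpool v hv (Finset.mem_sdiff.1 hvm).2) hm

/-- If some bulk close ever appears in the parentchain, it must be `cl` and it spreads to `q`. If
none ever does, the transaction sent together with the decision remains valid forever and gets
written. -/
theorem settlement (hr : ChildRun G E ct) {p q : P} (hq : q ∉ G.byz) {cl : Owners Acct Coin}
    (h : Decides E p Verdict.commit cl) :
    ∃ t S T, ParentTx.close cl S T ∈ (E t).parentLog q := by
  obtain ⟨t, S, T, hp, hS, hT, -, hpool⟩ := hr.written_of_commit h
  by_cases hcl : ∃ t', ∃ r ∉ G.byz, Closed ((E t').parentLog r)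
  · obtain ⟨t', r, hrb, cl', S', T', hm⟩ := hcl
    obtain rfl := hr.parent_close_eq hrb h hm
    obtain ⟨t'', ht''⟩ := (hr.parent.eventually_mem (Run.mem_correct hrb) hm).exists
    exact ⟨t'', S', T', ht'' q (Run.mem_correct hq)⟩
  · push Not at hcl
    obtain ⟨t₀, r, hrb, hc⟩ := hr.created
    obtain ⟨t'', ht''⟩ := (hr.parent.eventually_written (Finset.mem_sdiff.1 hp).2 hpool
      ((hr.eventually_creation hrb hc).mono fun t' ht' r hrm =>
        have hrb := (Finset.mem_sdiff.1 hrm).2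
        Or.inr ⟨hcl t' r hrb, ct, ht' r hrb, hS, hT⟩)).exists
    exact ⟨t'', S, T, ht'' q (Run.mem_correct hq)⟩

/-- What a correct user outside the childchain learns is shown by the committed bulk close. -/
theorem learned_subset (hr : ChildRun G E ct) {p q : P} {cl : Owners Acct Coin}
    (hq : Decides E q Verdict.commit cl) (hp : p ∉ G.byz) (hpm : p ∉ ct.members)
    (base : Owners Acct Coin) (t : ℕ) : learned base (E t) p ⊆ shown base cl := by
  rintro tr ((h | ⟨cl', S, hs, -⟩) | ⟨x, hx, htr⟩)
  · have h0 := hr.exec.child_eq_nil (p := p) (fun t ct' hi =>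
      hpm (Finset.mem_sdiff.1 (hr.inChild hp hi).2).1) t
    simp [State.childLog, h0] at h
  · obtain ⟨i, r, hrb, ct', hi, hv⟩ := hr.exec.sent_closeReq hs
    obtain ⟨rfl, -⟩ := hr.inChild hrb hi
    exact absurd (ct'.validators_subset_members hv) hpm
  · obtain ⟨hx, ha⟩ := not_isAbort_of_mem_sinceLastAbort hx
    cases x with
    | pay _ => exact htr.elim
    | create _ _ => exact htr.elim
    | close cl' S T => exact hr.parent_close_eq hp hq hx ▸ htr
    | abort _ => cases ha

theorem eventually_shown_subset (hr : ChildRun G E ct) {p q : P} {cl : Owners Acct Coin}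
    (hq : Decides E q Verdict.commit cl) (hp : p ∉ G.byz) (base : Owners Acct Coin) :
    ∃ t₀, ∀ t ≥ t₀, shown base cl ⊆ learned base (E t) p := by
  obtain ⟨t₀, S, T, h⟩ := hr.settlement hp hq
  refine ⟨t₀, fun t ht tr htr => Or.inr ⟨_, mem_sinceLastAbort (hr.parent_valid hp t)
    (((hr.exec.le ht).parentLog p).subset h), htr⟩⟩

theorem solvesOffchain (hr : ChildRun G E ct) : SolvesOffchain G E ct := by
  have key : ∀ p ∉ G.byz, ∀ t cl seq, Stmt.close cl ∈ (E t).signed p → Lists G E ct cl seq →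
      ∀ q ∈ ct.members \ G.byz, OnSeq G E ct (Decides E q Verdict.commit) seq ∨
        OnSeq G E ct (Decides E q Verdict.abort) seq := by
    intro p hp t cl seq h hl q hq
    rcases hr.commit_or_proposesAbort hp h with h | ⟨v, hv, h⟩
    · exact Or.inl ⟨cl, hl, h q hq⟩
    · exact Or.inr ⟨cl, hl, hr.decides_abort hv hq h⟩
  constructor
  · intro p cl h
    -- Launching, proposing and committing all reduce to one fact: some correct user has signed the
    -- bulk close.
    have hex : ∃ r ∉ G.byz, ∃ t, Stmt.close cl ∈ (E t).signed r := by
      rcases h with ⟨hp, t, h⟩ | h | ⟨-, h⟩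
      · exact ⟨p, hp, hr.exec.started h⟩
      · exact hr.signed_of_proposesCommit h
      · obtain ⟨r, h⟩ := hr.proposed_of_commit h
        exact hr.signed_of_proposesCommit h
    obtain ⟨r, hrb, t, hs⟩ := hex
    obtain ⟨seq, hseq⟩ := hr.lists_of_signed hrb hs
    exact ⟨seq, hseq, fun seq' h' => hr.lists_unique h' hseq⟩
  · rintro p hp seq ⟨cl, hl, t, h⟩
    obtain ⟨i, hi⟩ := hr.exec.started h
    exact key p hp i cl seq hi hl
  · rintro p seq ⟨cl, hl, h⟩
    obtain ⟨r, hrb, t, hs⟩ := hr.signed_of_proposesCommit h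
    exact key r hrb t cl seq hs hl
  · rintro p - seq ⟨cl, hl, h⟩
    obtain ⟨r, hr'⟩ := hr.proposed_of_commit h
    exact ⟨r, cl, hl, hr'⟩
  · exact fun p _ cl h q hq => hr.settlement hq h
  · rintro p - q - seq seq' ⟨cl, hl, h⟩ ⟨cl', hl', h'⟩
    obtain ⟨t, S, T, hp, -, -, hm, -⟩ := hr.written_of_commit h
    obtain ⟨t', S', T', hq, -, -, hm', -⟩ := hr.written_of_commit h'
    obtain rfl := hr.close_unique hp hq hm hm'
    exact hr.lists_unique hl hl'
  · rintro p hp seq ⟨cl, hl, h⟩ q hq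
    exact ⟨cl, hl, hr.decides_abort hp hq h⟩
  · exact fun p hp cl h q hq => hr.decides_abort hp hq h
  · rintro r seq ⟨cl, hl, h⟩ hno q hq
    obtain ⟨v, hv, t, hs⟩ := hr.signed_of_proposesCommit h
    rcases hr.commit_or_proposesAbort hv hs with h | ⟨v, hv, h⟩
    · exact ⟨cl, hl, h q hq⟩
    · exact absurd ⟨v, hv, cl, hl, h⟩ hno
  · rintro q - s₁ s₂ ⟨cl, ⟨-, hcl⟩, h⟩ p hp hpm
    -- Ownership after `s₁ ++ s₂` is ownership after `s₂` started from that after `s₁`, so the two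
    -- sets agree by definition.
    have e : minimalTransfers (ownersAfter ct.balances s₁) s₂ =
        shown (ownersAfter ct.balances s₁) cl := by
      rw [hcl, ownersAfter_append]
      rfl
    rw [e]
    refine ⟨hr.learned_subset h hp hpm _, ?_⟩
    obtain ⟨t₀, ht₀⟩ := hr.eventually_shown_subset h hp (ownersAfter ct.balances s₁)
    exact ⟨t₀, fun t ht => (hr.learned_subset h hp hpm _ t).antisymm (ht₀ t ht)⟩

end ChildRun

end Platypus

namespace Platypus

variable {P Acct Coin : Type*} {G : Setup P Acct Coin} {E : ℕ → State P Acct Coin}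

/-! ### Creation -/

theorem ValidFrom.left {Tx : Type*} {valid : List Tx → Tx → Prop} {H l l' : List Tx}
    (h : ValidFrom valid H (l ++ l')) : ValidFrom valid H l := by
  induction l generalizing H with
  | nil => trivial
  | cons x l ih => exact ⟨h.1, ih h.2⟩

/-- As long as no childchain is created, a coin keeps its owner unless this owner spends it. -/
theorem parentOwner_of_prefix {H H' : List (ParentTx P Acct Coin)} (hpre : H <+: H')
    (hv : ValidFrom (parentValid G) [] H') (hn : creation H' = none) {c : Coin}
    (hpay : ∀ tr, ParentTx.pay tr ∈ H' → tr.coin = c → tr.src ≠ parentOwner G H c) :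
    parentOwner G H' c = parentOwner G H c := by
  obtain ⟨l, rfl⟩ := hpre
  induction l using List.reverseRecOn with
  | nil => simp
  | append_singleton l x ih =>
    rw [← List.append_assoc] at hv hn hpay ⊢
    have hn' : ∀ ct, creation (H ++ l) ≠ some ct := fun ct h => by
      rw [creation_of_prefix (List.prefix_append _ _) h] at hn
      cases hn
    have ih' := ih hv.left (Option.eq_none_iff_forall_ne_some.2 hn')
      fun tr h => hpay tr (List.mem_append_left _ h)
    have hx : parentValid G (H ++ l) x := by simpa using hv.valid_of_append (l₂ := []) rfl
    -- Without a creation no bulk close is valid, so only a payment can change an owner; a valid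
    -- payment of this coin would come from its current owner, which `hpay` excludes.
    have e : parentOwner G (H ++ l ++ [x]) c = parentOwner G (H ++ l) c := by
      simp only [parentOwner, List.foldl_append (l := H ++ l), List.foldl_cons, List.foldl_nil]
      cases x with
      | pay tr =>
        refine Function.update_of_ne (fun hc => ?_) _ _
        refine hpay tr (by simp) hc.symm ?_
        rw [← ih', hc]
        exact hx.2.symm
      | create ct S => rfl
      | close cl S T =>
        obtain ⟨-, ct, hc, -⟩ := hx
        exact absurd hc (hn' ct)
      | abort ab => rfl
    rw [e, ih']

theorem gather_joined (s : State P Acct Coin) (p : P) (j : Join P Coin) :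
    (gather G s p j).joined p = insert j (s.joined p) := by
  unfold gather
  dsimp only
  split_ifs <;> simp [State.sign, State.multicast, State.addJoin]

theorem Execution.joined_distinct (hE : Execution G E) (p : P) (t : ℕ) :
    ∀ j ∈ (E t).joined p, ∀ j' ∈ (E t).joined p, j.sender = j'.sender → j = j' := by
  induction t with
  | zero => simp [hE.start, State.start]
  | succ t ih =>
    by_cases hc : (E (t + 1)).joined p = (E t).joined p
    · rwa [hc]
    · obtain ⟨-, j₀, ⟨-, -, -, h⟩, he⟩ := (hE.step t).joined hc
      rw [he, gather_joined]
      intro j hj j' hj' hs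
      rcases Finset.mem_insert.1 hj with rfl | hjm <;>
        rcases Finset.mem_insert.1 hj' with rfl | hjm'
      · rfl
      · exact absurd hs.symm (h j' hjm')
      · exact absurd hs (h j hjm)
      · exact ih j hjm j' hjm' hs

theorem Execution.joined_spec (hE : Execution G E) {p : P} {t : ℕ} {j : Join P Coin}
    (h : j ∈ (E t).joined p) :
    ∃ i < t, Msg.join j ∈ (E i).rcvd p ∧ JoinOK G ((E i).parentLog p) j := by
  obtain ⟨i, hi, h0, h1⟩ := exists_step_of_not_zero
    (Q := fun t => j ∈ (E t).joined p) (by simp [hE.start, State.start]) h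
  obtain ⟨-, j₀, hg, he⟩ := (hE.step i).joined (p := p) fun hc => h0 (hc ▸ h1)
  rw [he, gather_joined] at h1
  obtain rfl := (Finset.mem_insert.1 h1).resolve_right h0
  exact ⟨i, hi, hg.2.1, hg.2.2.1⟩

theorem volunteers_insert (j : Join P Coin) (J : Finset (Join P Coin)) :
    volunteers (insert j J) =
      if j.validator = true then insert j.sender (volunteers J) else volunteers J := by
  unfold volunteers
  rw [Finset.filter_insert]
  split_ifs
  · rw [Finset.image_insert]
  · rfl

/-- A volunteer who gathers enough validators multicasts a creation transaction. -/
theorem Execution.createReq_sent (hE : Execution G E) {p : P} {t : ℕ} (hmv : 0 < G.mv)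
    (h : G.mv ≤ (volunteers ((E t).joined p)).card) :
    ∃ i, ∃ ct : CreateTx P Acct Coin, ct.validators.card = G.mv ∧
      ct.joins = (E (i + 1)).joined p ∧
      ct.balances = balancesOf G ((E i).parentLog p) ct.joins ∧
      ∀ v ∈ ct.validators, (v, Msg.createReq ct {p}) ∈ (E (i + 1)).sent := by
  -- The relevant step is one at which the number of gathered volunteers reaches `G.mv`; positivity
  -- of `G.mv` excludes the initial state.
  obtain ⟨i, hi, h0, h1⟩ := exists_step_of_not_zero
    (Q := fun t => G.mv ≤ (volunteers ((E t).joined p)).card)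
    (by simp [hE.start, State.start, volunteers]; omega) h
  obtain ⟨-, j, hg, he⟩ := (hE.step i).joined (p := p) fun hc => h0 (by simpa only [hc] using h1)
  have hj : (E (i + 1)).joined p = insert j ((E i).joined p) := by rw [he, gather_joined]
  rw [hj, volunteers_insert] at h1
  split_ifs at h1 with hval
  swap
  · exact absurd h1 h0
  -- One message adds at most one volunteer, so the threshold is hit exactly, as the branching
  -- condition of `gather` requires.
  have hle := Finset.card_insert_le j.sender (volunteers ((E i).joined p))
  have hct : (mkCreate G ((E i).addJoin p j) p).joins = insert j ((E i).joined p) := by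
    simp [mkCreate, State.addJoin]
  have hcard : (mkCreate G ((E i).addJoin p j) p).validators.card = G.mv := by
    rw [CreateTx.validators, hct, volunteers_insert, if_pos hval]
    omega
  refine ⟨i, mkCreate G ((E i).addJoin p j) p, hcard, hct.trans hj.symm, rfl, fun v hv => ?_⟩
  rw [he, gather]
  rw [if_pos ⟨hval, hcard⟩]
  exact Or.inr ⟨hv, rfl⟩

/-- No correct user ever sees a coin offered in `j` spent by the sender of `j`. -/
def Unspent (G : Setup P Acct Coin) (E : ℕ → State P Acct Coin) (j : Join P Coin) : Prop :=
  ∀ t, ∀ q ∉ G.byz, ∀ tr : Transfer Acct Coin, tr.coin ∈ j.coins → G.ctrl tr.src = j.sender →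
    ParentTx.pay tr ∉ (E t).parentLog q

namespace Run

variable [Fintype P]

theorem parentOwner_eq (hr : Run G E)
    (hnone : ∀ t, ∀ q ∉ G.byz, creation ((E t).parentLog q) = none) {H : List (ParentTx P Acct Coin)}
    {q : P} (hq : q ∉ G.byz) {t : ℕ} (hpre : H <+: (E t).parentLog q) {j : Join P Coin}
    (hj : JoinOK G H j) (hu : Unspent G E j) {c : Coin} (hc : c ∈ j.coins) :
    parentOwner G ((E t).parentLog q) c = parentOwner G H c := by
  refine parentOwner_of_prefix hpre (hr.parent_valid hq t) (hnone t q hq) ?_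
  rintro tr hm rfl hs
  exact hu t q hq tr hc (hs ▸ hj _ hc) hm

theorem joinOK_of_prefix (hr : Run G E)
    (hnone : ∀ t, ∀ q ∉ G.byz, creation ((E t).parentLog q) = none) {H : List (ParentTx P Acct Coin)}
    {q : P} (hq : q ∉ G.byz) {t : ℕ} (hpre : H <+: (E t).parentLog q) {j : Join P Coin}
    (hj : JoinOK G H j) (hu : Unspent G E j) : JoinOK G ((E t).parentLog q) j := by
  intro c hc
  rw [hr.parentOwner_eq hnone hq hpre hj hu hc]
  exact hj c hc

/-- A volunteer gathers the join message of every correct volunteer. -/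
theorem exists_joined (hr : Run G E)
    (hnone : ∀ t, ∀ q ∉ G.byz, creation ((E t).parentLog q) = none)
    (hu : ∀ t, ∀ p ∉ G.byz, ∀ j, Msg.join j ∈ (E t).rcvd p → Unspent G E j)
    {p q : P} (hp : p ∉ G.byz) (hq : q ∉ G.byz) {t t' : ℕ} (hpv : Volunteered (E t) p)
    (hqv : Volunteered (E t') q) : ∃ t, q ∈ volunteers ((E t).joined p) := by
  obtain ⟨j, rfl, hval, hj⟩ := hqv
  obtain ⟨i, -, -, ⟨-, -, -, hok⟩, hsent⟩ := hr.exec.signed_join hj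
  have hrc := hr.eventually_rcvd hp (hsent p)
  obtain ⟨t₁, ht₁⟩ := hrc.exists
  by_contra hno
  push Not at hno
  -- If the message were never gathered, gathering it would stay enabled forever, against fairness.
  have hen : ∀ᶠ t in Filter.atTop, GatherEnabled G (E t) p j := by
    filter_upwards [hrc, Filter.eventually_ge_atTop t,
      hr.parent.eventually_prefix (mem_correct hq) (mem_correct hp) i] with t₂ hrc₂ ht₂ hpre
    obtain ⟨k, hk, hkv, hks⟩ := hpv
    refine ⟨⟨k, hk, hkv, (hr.exec.le ht₂).signed p hks⟩, hrc₂,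
      hr.joinOK_of_prefix hnone hp hpre.flatten hok (hu t₁ p hp j ht₁), fun j' hj' hs => ?_⟩
    -- A gathered message of the same correct sender is authentic, and such a sender signs only one
    -- join message. It would therefore be `j` itself, which `hno` excludes.
    have hsig := (hr.exec.authentic t₂).joined p j' hj' j'.sender (by simp) (hs ▸ hq)
    rw [hs] at hsig
    obtain rfl := hr.exec.join_unique hj hsig
    exact hno t₂ (Finset.mem_image_of_mem _ (Finset.mem_filter.2 ⟨hj', hval⟩))
  obtain ⟨t₀, hen⟩ := Filter.eventually_atTop.1 hen
  obtain ⟨t₂, ht₂, h⟩ := hr.exec.fair.gather p hp j t₀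
  exact h (hen t₂ ht₂)

/-- The creation transaction multicast by a volunteer is eventually verified by every correct
user. -/
theorem eventually_verifyCreate (hr : Run G E)
    (hnone : ∀ t, ∀ q ∉ G.byz, creation ((E t).parentLog q) = none)
    (hu : ∀ t, ∀ p ∉ G.byz, ∀ j, Msg.join j ∈ (E t).rcvd p → Unspent G E j)
    {p : P} (hp : p ∉ G.byz) {i : ℕ} {ct : CreateTx P Acct Coin}
    (hcard : ct.validators.card = G.mv) (hjoins : ct.joins = (E (i + 1)).joined p)
    (hbal : ct.balances = balancesOf G ((E i).parentLog p) ct.joins) :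
    ∀ᶠ t in Filter.atTop, ∀ q ∉ G.byz, VerifyCreate G ((E t).parentLog q) ct := by
  filter_upwards [hr.parent.eventually_all_prefix (mem_correct hp) i] with t ht q hq
  have hpre : (E i).parentLog p <+: (E t).parentLog q := (ht q (mem_correct hq)).flatten
  have hok : ∀ j ∈ ct.joins, JoinOK G ((E i).parentLog p) j ∧ Unspent G E j := by
    intro j hj
    obtain ⟨i', hi', hrc, hok⟩ := hr.exec.joined_spec (hjoins ▸ hj)
    have hun := hu i' p hp j hrc
    -- A message present at `i + 1` was gathered at some `i' ≤ i`, so the deposit checked then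
    -- carries over to the log at `i`, from which the balances are computed.
    exact ⟨hr.joinOK_of_prefix hnone hp ((hr.exec.le (Nat.le_of_lt_succ hi')).parentLog p) hok hun,
      hun⟩
  refine ⟨hcard, ?_, fun j hj => hr.joinOK_of_prefix hnone hq hpre (hok j hj).1 (hok j hj).2, ?_⟩
  · rw [hjoins]
    exact hr.exec.joined_distinct p (i + 1)
  · rw [hbal]
    funext c
    unfold balancesOf
    split_ifs with hc
    · obtain ⟨j, hj, hcj⟩ := hc
      rw [hr.parentOwner_eq hnone hq hpre (hok j hj).1 (hok j hj).2 hcj]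
    · rfl

theorem creationTerminates (hr : Run G E) : CreationTerminates G E := by
  rintro ⟨W, hW, hvol⟩ hspend
  have hu : ∀ t, ∀ p ∉ G.byz, ∀ j, Msg.join j ∈ (E t).rcvd p → Unspent G E j :=
    fun t p hp j hj t' q hq tr hc hs => hspend t t' p hp q hq j tr hj hc hs
  have hmv : 0 < G.mv := lt_of_le_of_lt (Nat.zero_le _) hr.few
  by_contra hno
  -- A creation seen by one correct user spreads to all, so failure means that no correct user ever
  -- sees any. This keeps owners fixed and the guards of the creation rules satisfied.
  have hnone : ∀ t, ∀ q ∉ G.byz, creation ((E t).parentLog q) = none := by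
    intro t q hq
    refine Option.eq_none_iff_forall_ne_some.2 fun ct hc => hno ⟨ct, fun q' hq' => ?_⟩
    exact (hr.eventually_creation hq hc).exists.imp fun t h => h q' hq'
  obtain ⟨p, hpW⟩ := Finset.card_pos.1 (hmv.trans_le hW)
  obtain ⟨hp, t, hpv⟩ := hvol p hpW
  -- A single volunteer `p` collects the join messages of all of `W`, hence at least `G.mv`
  -- validators.
  have hall : ∀ᶠ t in Filter.atTop, ∀ q ∈ W, q ∈ volunteers ((E t).joined p) := by
    refine (Filter.eventually_all_finset _).2 fun q hqW => ?_
    obtain ⟨hq, t', hqv⟩ := hvol q hqW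
    obtain ⟨t₁, ht₁⟩ := hr.exists_joined hnone hu hp hq hpv hqv
    filter_upwards [Filter.eventually_ge_atTop t₁] with t₂ ht₂
    exact Finset.image_subset_image
      (Finset.filter_subset_filter _ ((hr.exec.le ht₂).joined p)) ht₁
  obtain ⟨t₁, ht₁⟩ := hall.exists
  obtain ⟨i, ct, hcard, hjoins, hbal, hsent⟩ :=
    hr.exec.createReq_sent hmv (hW.trans (Finset.card_le_card ht₁))
  have hver := hr.eventually_verifyCreate hnone hu hp hcard hjoins hbal
  have hth : threshold G.mv ≤ (ct.validators \ G.byz).card :=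
    hcard ▸ threshold_le_card_sdiff (hcard ▸ hr.few)
  have hprop : ∃ j S, ∃ v ∉ G.byz, threshold G.mv ≤ (S ∩ ct.validators).card ∧
      (v, ParentTx.create ct S) ∈ (E j).parentPool := by
    refine of_signatures_accumulate
      (M := fun S => ∃ j, ∀ v ∈ ct.validators, (v, Msg.createReq ct S) ∈ (E j).sent)
      (Finset.sdiff_subset (s := ct.validators) (t := G.byz)) hth
      (Finset.card_pos.1 (lt_of_lt_of_le (Nat.succ_pos _) hth)) ?_ ⟨i + 1, hsent⟩
    rintro S ⟨j, hS⟩ v hv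
    obtain ⟨hvV, hvb⟩ := Finset.mem_sdiff.1 hv
    have hen : ∀ᶠ t in Filter.atTop, SignCreateEnabled G (E t) v ct S := by
      filter_upwards [hver, hr.eventually_rcvd hvb (hS v hvV)] with t hvt hrc
      exact ⟨hvV, hrc, hnone t v hvb, hvt v hvb⟩
    obtain ⟨t₀, hen⟩ := Filter.eventually_atTop.1 hen
    obtain ⟨t, ht, hd⟩ := hr.exec.fair.signCreate v hvb ct S t₀
    have hd := hd (hen t ht)
    unfold SignCreateDone at hd
    split_ifs at hd with hQ
    · exact Or.inr ⟨⟨t, hd⟩, hQ⟩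
    · exact Or.inl ⟨t, _, v, hvb, not_lt.1 hQ, hd⟩
  obtain ⟨j, S, v, hv, hQ, hpool⟩ := hprop
  -- Verified funds and the standing absence of a creation keep the transaction valid, so it is
  -- written, contradicting `hnone`.
  obtain ⟨t₂, ht₂⟩ := (hr.parent.eventually_written hv hpool (hver.mono fun t ht q hqm =>
    have hq := (Finset.mem_sdiff.1 hqm).2
    Or.inr ⟨hnone t q hq, hQ, (ht q hq).2.2⟩)).exists
  exact creation_ne_none_of_mem (ht₂ p (mem_correct hp)) (hnone t₂ p hp)

end Run

end Platypus

theorem mainTheorem1 {P Acct Coin : Type*} [Fintype P]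
    (G : Platypus.Setup P Acct Coin) (E : ℕ → Platypus.State P Acct Coin)
    (hchild : 3 * G.byz.card < G.mv)
    (hparent : 3 * (G.byz ∩ G.parentValidators).card < G.parentValidators.card)
    (hE : Platypus.Execution G E) (hsync : Platypus.PartialSynchrony G E)
    (hΩ : Platypus.ParentBFT G E) (hΨ : Platypus.ChildBFT G E) :
    Platypus.CreationTerminates G E ∧
      ∀ ct, Platypus.Created G E ct →
        Platypus.Bootstrapped G E ct ∧ Platypus.SolvesOffchain G E ct := by
  have hr : Platypus.Run G E :=
    ⟨hchild, hE, hsync.delivery, hΩ.soundChain hparent fun p _ _ h => (hE.le h).parent p⟩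
  refine ⟨hr.creationTerminates, fun ct hct => ⟨hr.bootstrapped hct, ?_⟩⟩
  -- The childchain has exactly `G.mv` validators, so the bound on all Byzantine users becomes the
  -- consensus hypothesis for the childchain.
  have hV : 3 * (G.byz ∩ ct.validators).card < ct.validators.card := by
    have h1 := Finset.card_le_card (Finset.inter_subset_left (s₁ := G.byz) (s₂ := ct.validators))
    have h2 := (hr.bootstrapped hct).validators_card
    omega
  exact Platypus.ChildRun.solvesOffchain
    ⟨hr, hct, (hΨ ct hct).soundChain hV fun p _ _ h => (hE.le h).child p⟩
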